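/- Let $\mathbb N=\{1,2,3,\dots\}$. For $\mathbf k=(k_1,\dots,k_r)\in\mathbb N^r$ and $n\ge 0$ put $$\zeta_n(\mathbf k)=\sum_{n\ge n_1>\cdots>n_r>0}\frac1{n_1^{k_1}\cdots n_r^{k_r}},\qquad t_n(\mathbf k)=\sum_{n\ge n_1>\cdots>n_r>0}\prod_{j=1}^r\frac1{(2n_j-1)^{k_j}},\qquad t_n^\star(\mathbf k)=\sum_{n\ge n_1\ge\cdots\ge n_r>0}\prod_{j=1}^r\frac1{(2n_j-1)^{k_j}},$$ with value $1$ for the empty composition and $0$ for an empty sum, and let $a_d$ denote the sequence $(a,\dots,a)$ with $d$ entries. For $r\ge1$, $\mathbf k\in\mathbb N^r$ and $N$-th roots of unity $z_1,\dots,z_r$ with $(k_1,z_1)\ne(1,1)$, the number $$\mathrm{Li}_{\mathbf k}(z_1,\dots,z_r)=\lim_{M\to\infty}\ \sum_{M\ge n_1>\cdots>n_r>0}\frac{z_1^{n_1}\cdots z_r^{n_r}}{n_1^{k_1}\cdots n_r^{k_r}}$$ is called a colored multiple zeta value of level $N$ and weight $k_1+\cdots+k_r$, and $\mathrm{CMZV}^N_w\subset\mathbb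 C$ denotes the $\mathbb Q$-linear span of all colored multiple zeta values of level $N$ and weight $w$. Then for all $p,k,m\in\mathbb N$ the following two series converge, and $$\sum_{n=p-1}^\infty\left[\frac1{4^n}\binom{2n}{n}\right]^2\frac{t_n(2_{p-1})}{(2n+1)^m}\in\frac{i}{\pi}\,\mathrm{CMZV}^4_{2p+m-1},\qquad \sum_{n=p}^\infty\left[\frac{4^n}{\binom{2n}{n}}\right]^2\frac{\zeta_{n-1}(2_{p-1})\,t_n^\star(1_k)}{n^{m+2}}\in\mathrm{CMZV}^4_{2p+k+m}.$$ -/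

import Mathlib

/-- The nested sum `∑_{N ≥ n₁ > n₂ > ⋯ > n_r > 0} f₁ n₁ * f₂ n₂ * ⋯ * f_r n_r`
attached to the list `[f₁, …, f_r]`; it is `1` for the empty list. -/
def nestedSum {R : Type*} [Semiring R] : List (ℕ → R) → ℕ → R
  | [], _ => 1
  | f :: L, N => ∑ n ∈ Finset.Icc 1 N, f n * nestedSum L (n - 1)

/-- The nested sum `∑_{N ≥ n₁ ≥ n₂ ≥ ⋯ ≥ n_r > 0} f₁ n₁ * f₂ n₂ * ⋯ * f_r n_r`
attached to the list `[f₁, …, f_r]`; it is `1` for the empty list. -/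
def nestedStarSum {R : Type*} [Semiring R] : List (ℕ → R) → ℕ → R
  | [], _ => 1
  | f :: L, N => ∑ n ∈ Finset.Icc 1 N, f n * nestedStarSum L n

/-- The multiple harmonic sum `ζ_n(k₁, …, k_r)`. -/
noncomputable def multipleHarmonicSum (n : ℕ) (k : List ℕ) : ℝ :=
  nestedSum (k.map fun a j => 1 / (j : ℝ) ^ a) n

/-- The multiple `t`-harmonic sum `t_n(k₁, …, k_r)`. -/
noncomputable def multipleTHarmonicSum (n : ℕ) (k : List ℕ) : ℝ :=
  nestedSum (k.map fun a j => 1 / (2 * (j : ℝ) - 1) ^ a) n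

/-- The multiple `t`-harmonic star sum `t⋆_n(k₁, …, k_r)`. -/
noncomputable def multipleTHarmonicStarSum (n : ℕ) (k : List ℕ) : ℝ :=
  nestedStarSum (k.map fun a j => 1 / (2 * (j : ℝ) - 1) ^ a) n

/-- The partial sum `∑_{M ≥ n₁ > ⋯ > n_r > 0} z₁^{n₁} ⋯ z_r^{n_r} / (n₁^{k₁} ⋯ n_r^{k_r})` of
`Li_{k₁,…,k_r}(z₁, …, z_r)`, where `L = [(k₁, z₁), …, (k_r, z_r)]`. -/
noncomputable def coloredPartialSum (L : List (ℕ × ℂ)) (M : ℕ) : ℂ :=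
  nestedSum (L.map fun a j => a.2 ^ j / (j : ℂ) ^ a.1) M

/-- `IsColoredMZV N w x`: the number `x` is a colored multiple zeta value `Li_k(z)` of level `N` and
weight `w`. The series may converge only conditionally, and `Li_k(z)` is the limit of
the partial sums over `n₁ ≤ M` as `M → ∞`. -/
def IsColoredMZV (N w : ℕ) (x : ℂ) : Prop :=
  ∃ L : List (ℕ × ℂ),
    L ≠ [] ∧
    (∀ a ∈ L, 1 ≤ a.1 ∧ a.2 ^ N = 1) ∧
    L.head? ≠ some (1, 1) ∧
    (L.map Prod.fst).sum = w ∧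
    Filter.Tendsto (coloredPartialSum L) Filter.atTop (nhds x)

/-- The `ℚ`-span of all colored multiple zeta values of level `N` and weight `w`. -/
noncomputable def CMZV (N w : ℕ) : Submodule ℚ ℂ :=
  Submodule.span ℚ {x : ℂ | IsColoredMZV N w x}

/-!
Substitute `x = sin θ` with `t = tan (θ / 2)`, so that `sin θ = 2t / (1 + t²)` and
`cos θ = (1 - t²) / (1 + t²)`. Both series then become integrals over `0 < t < 1` of iterated
integrals in the letters `dt / t` and `a dt / (1 - a t)` with `a ∈ {1, -1, I, -I}`.

* The Taylor coefficients of `arcsin x ^ q / q!` are, up to elementary factors, the numbers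
  `binom(2n, n) / 4 ^ n * t_n(2, …, 2)` for `q` odd (`arcsinPowCoeff_odd`) and
  `4 ^ n / binom(2n, n) * ζ_{n-1}(2, …, 2)` for `q` even (`arcsinPowCoeff_even`); see
  `hasSum_arcsin_pow`.
* The second factors are Wallis integrals in `dθ / sin θ = dt / t`: the powers `sin θ ^ (2n + 1)`
  give `π / 2 * binom(2n, n) / 4 ^ n` (`logWallis_odd`), and `sin θ ^ (2n) (-log cos θ) ^ k / k!` gives
  `4 ^ n / binom(2n, n) * t⋆_n(1, …, 1) / (2n)` (`logWallis_even`).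

All terms are nonnegative, so sum and integral may be interchanged, and each series is a multiple of
the integral over `dt / t` of `(-log cos θ) ^ k / k! * ∑ c_n (sin θ) ^ n / n ^ m`, with `c_n` the
coefficients of `arcsin x ^ q / q!`. The differentials `dθ`, `d log (sin θ)` and `d (-log cos θ)`
are combinations of the letters above, rational except for a factor `I` in `dθ`. Hence `I ^ q` times
the integrand is a rational combination of polylogarithms (`logArcsinPolylog_mem`). Iterated
integrals are not formed explicitly: a function belongs to the span of polylogarithms as soon as its
Euler derivative `t f'` does in the appropriate sense (`mem_polylogFun_of_hasDerivAt`).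

Since the outermost form is always `dt / t`, every multiple zeta value that arises has leading
exponent at least `2`, so all series converge absolutely and no regularization is needed
(`integral_div_mem_CMZV`).
-/

open Filter Topology MeasureTheory Set Finset

/-! ### Power series coefficients of colored polylogarithms -/

/-- The coefficient of `t ^ n` in the iterated integral attached to `L = [(k₁, a₁), …, (k_r, a_r)]`,
namely `∑_{n = n₁ > ⋯ > n_r > 0} ∏ a_j ^ (n_j - n_{j+1}) / n_j ^ k_j` with `n_{r+1} = 0`. In
terms of iterated integrals, each entry contributes `k - 1` forms `dt / t` and one form
`a dt / (1 - a t)`. -/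
noncomputable def polylogCoeff : List (ℕ × ℂ) → ℕ → ℂ
  | [], n => if n = 0 then 1 else 0
  | (k, a) :: L, n => (∑ l ∈ Finset.range n, a ^ (n - l) * polylogCoeff L l) / (n : ℂ) ^ k

/-- The `ℚ`-span of the coefficient sequences of the polylogarithms of level `N` and weight `w`. -/
noncomputable def polylogSpan (N w : ℕ) : Submodule ℚ (ℕ → ℂ) :=
  Submodule.span ℚ {c | ∃ L : List (ℕ × ℂ), (∀ a ∈ L, 1 ≤ a.1 ∧ a.2 ^ N = 1) ∧
    (L.map Prod.fst).sum = w ∧ c = polylogCoeff L}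

/-- Passing from the letters `a_j` of iterated integrals to the arguments `z_j = a_j / a_{j-1}` of
colored multiple zeta values, where `a₀ = b`. -/
noncomputable def letterRatios : ℂ → List (ℕ × ℂ) → List (ℕ × ℂ)
  | _, [] => []
  | b, (k, a) :: L => (k, a / b) :: letterRatios a L

lemma polylogCoeff_cons_zero (k : ℕ) (a : ℂ) (L : List (ℕ × ℂ)) :
    polylogCoeff ((k, a) :: L) 0 = 0 := by
  simp [polylogCoeff]

lemma polylogCoeff_succ_exponent (k : ℕ) (a : ℂ) (L : List (ℕ × ℂ)) (n : ℕ) :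
    polylogCoeff ((k + 1, a) :: L) n = polylogCoeff ((k, a) :: L) n / n := by
  simp [polylogCoeff, pow_succ, div_div]

/-- The conversion of the coefficients of an iterated integral into nested sums. -/
lemma sum_inv_pow_mul_polylogCoeff (L : List (ℕ × ℂ)) :
    ∀ b : ℂ, b ≠ 0 → (∀ a ∈ L, a.2 ≠ 0) → ∀ n, 1 ≤ n →
    ∑ l ∈ Finset.range n, (b ^ l)⁻¹ * polylogCoeff L l =
      coloredPartialSum (letterRatios b L) (n - 1) := by
  induction L with
  | nil =>
    intro b hb _ n hn
    simp [polylogCoeff, letterRatios, coloredPartialSum, nestedSum]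
    lia
  | cons x L ih =>
    obtain ⟨k, a⟩ := x
    intro b hb hL n hn
    have ha : a ≠ 0 := hL (k, a) (by simp)
    have key : ∀ l, 1 ≤ l → (b ^ l)⁻¹ * polylogCoeff ((k, a) :: L) l =
        (a / b) ^ l / (l : ℂ) ^ k * coloredPartialSum (letterRatios a L) (l - 1) := by
      intro l hl
      rw [← ih a ha (fun y hy => hL y (by simp [hy])) l hl, polylogCoeff, Finset.mul_sum,
        Finset.sum_div, Finset.mul_sum]
      refine Finset.sum_congr rfl fun j hj => ?_
      rw [Finset.mem_range] at hj
      rw [pow_sub₀ a ha hj.le, div_pow]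
      field_simp
    obtain ⟨n, rfl⟩ : ∃ n', n = n' + 1 := ⟨n - 1, by lia⟩
    rw [Finset.sum_range_succ', polylogCoeff_cons_zero]
    simp only [coloredPartialSum, letterRatios, List.map_cons, nestedSum, mul_zero, add_zero,
      Nat.add_sub_cancel]
    rw [Finset.range_eq_Ico,
      Finset.sum_Ico_add' (fun l => (b ^ l)⁻¹ * polylogCoeff ((k, a) :: L) l)]
    refine Finset.sum_congr (by ext; simp) fun l hl => ?_
    rw [key l (by simp at hl; lia)]
    rfl

lemma letterRatios_valid {N : ℕ} (L : List (ℕ × ℂ)) : ∀ b : ℂ, b ^ N = 1 →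
    (∀ a ∈ L, 1 ≤ a.1 ∧ a.2 ^ N = 1) → ∀ a ∈ letterRatios b L, 1 ≤ a.1 ∧ a.2 ^ N = 1 := by
  induction L with
  | nil => simp [letterRatios]
  | cons x L ih =>
    intro b hb hL a ha
    have hx := hL x (by simp)
    rcases List.mem_cons.1 ha with rfl | ha
    · exact ⟨hx.1, by rw [div_pow, hx.2, hb, div_one]⟩
    · exact ih x.2 hx.2 (fun y hy => hL y (by simp [hy])) a ha

lemma map_fst_letterRatios (L : List (ℕ × ℂ)) : ∀ b, (letterRatios b L).map Prod.fst =
    L.map Prod.fst := by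
  induction L with
  | nil => simp [letterRatios]
  | cons x L ih => intro b; simp [letterRatios, ih]

lemma sum_range_inv_sqrt_le (n : ℕ) : ∑ l ∈ Finset.range n, (√(l : ℝ))⁻¹ ≤ 2 * √(n : ℝ) := by
  have key : ∀ n : ℕ, ∑ l ∈ Finset.range (n + 1), (√(l : ℝ))⁻¹ ≤ 2 * √(n : ℝ) := by
    intro n
    induction n with
    | zero => simp
    | succ n ih =>
      rw [Finset.sum_range_succ]
      have h0 : (0 : ℝ) < √((n + 1 : ℕ) : ℝ) := Real.sqrt_pos.2 (by positivity)
      have h1 : √(n : ℝ) ^ 2 = n := Real.sq_sqrt (by positivity)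
      have h2 : √((n + 1 : ℕ) : ℝ) ^ 2 = n + 1 := by
        rw [Real.sq_sqrt (by positivity)]; push_cast; rfl
      have h3 : (√((n + 1 : ℕ) : ℝ))⁻¹ ≤ 2 * √((n + 1 : ℕ) : ℝ) - 2 * √(n : ℝ) := by
        rw [inv_le_iff_one_le_mul₀ h0]
        nlinarith [sq_nonneg (√((n + 1 : ℕ) : ℝ) - √(n : ℝ))]
      linarith
  rcases n with _ | n
  · simp
  · refine (key n).trans ?_
    gcongr
    simp

lemma norm_polylogCoeff_cons_le {k : ℕ} (hk : 1 ≤ k) {a : ℂ} (ha : ‖a‖ = 1) {L : List (ℕ × ℂ)}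
    {B : ℝ} (hB : 0 ≤ B)
    (h : ∀ n, ∑ l ∈ Finset.range n, ‖polylogCoeff L l‖ ≤ B * √(n : ℝ)) (n : ℕ) :
    ‖polylogCoeff ((k, a) :: L) n‖ ≤ B * (√(n : ℝ))⁻¹ := by
  rcases Nat.eq_zero_or_pos n with rfl | hn
  · simp [polylogCoeff_cons_zero]
  have h0 : (0 : ℝ) < √(n : ℝ) := Real.sqrt_pos.2 (by exact_mod_cast hn)
  have h1 : √(n : ℝ) ^ 2 = n := Real.sq_sqrt (by positivity)
  have hn1 : (1 : ℝ) ≤ n := by exact_mod_cast hn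
  rw [polylogCoeff, norm_div, norm_pow, Complex.norm_natCast]
  calc _ ≤ (B * √(n : ℝ)) / (n : ℝ) ^ 1 := by
        refine div_le_div₀ (by positivity) ?_ (by positivity) (pow_le_pow_right₀ hn1 hk)
        refine (norm_sum_le _ _).trans ((Finset.sum_le_sum fun j _ => ?_).trans (h n))
        simp [ha]
    _ = _ := by
        nth_rewrite 2 [← h1]
        field_simp

lemma exists_sum_norm_polylogCoeff_le {N : ℕ} (hN : N ≠ 0) (L : List (ℕ × ℂ))
    (hL : ∀ a ∈ L, 1 ≤ a.1 ∧ a.2 ^ N = 1) :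
    ∃ B : ℝ, 0 ≤ B ∧ ∀ n, ∑ l ∈ Finset.range n, ‖polylogCoeff L l‖ ≤ B * √(n : ℝ) := by
  induction L with
  | nil =>
    refine ⟨1, zero_le_one, fun n => ?_⟩
    rcases n with _ | n
    · simp
    rw [Finset.sum_range_succ']
    simp [polylogCoeff]
  | cons x L ih =>
    obtain ⟨k, a⟩ := x
    obtain ⟨B, hB, h⟩ := ih (fun y hy => hL y (by simp [hy]))
    obtain ⟨hk, ha⟩ := hL (k, a) (by simp)
    have hna : ‖a‖ = 1 := Complex.norm_eq_one_of_pow_eq_one ha hN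
    refine ⟨B * 2, by positivity, fun n => ?_⟩
    calc _ ≤ ∑ l ∈ Finset.range n, B * (√(l : ℝ))⁻¹ :=
          Finset.sum_le_sum fun l _ => norm_polylogCoeff_cons_le hk hna hB h l
      _ ≤ B * (2 * √(n : ℝ)) := by
        rw [← Finset.mul_sum]
        exact mul_le_mul_of_nonneg_left (sum_range_inv_sqrt_le n) hB
      _ = _ := by ring

lemma exists_cons_of_weight_succ {L : List (ℕ × ℂ)} {w : ℕ} (h : (L.map Prod.fst).sum = w + 1) :
    ∃ x L', L = x :: L' := by
  cases L with
  | nil => simp at h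
  | cons x L' => exact ⟨x, L', rfl⟩

/-- In positive weight the coefficients are `O(n ^ (-1/2))`, which makes `∑ c n / n` absolutely
convergent. -/
lemma exists_norm_le_of_mem_polylogSpan_succ {N w : ℕ} (hN : N ≠ 0) {c : ℕ → ℂ}
    (hc : c ∈ polylogSpan N (w + 1)) : ∃ B : ℝ, ∀ n : ℕ, ‖c n‖ ≤ B * (√(n : ℝ))⁻¹ := by
  induction hc using Submodule.span_induction with
  | mem c hc =>
    obtain ⟨L, hL, hw, rfl⟩ := hc
    obtain ⟨⟨k, a⟩, L, rfl⟩ := exists_cons_of_weight_succ hw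
    obtain ⟨B, hB, h⟩ := exists_sum_norm_polylogCoeff_le hN L (fun y hy => hL y (by simp [hy]))
    obtain ⟨hk, ha⟩ := hL (k, a) (by simp)
    exact ⟨B, norm_polylogCoeff_cons_le hk (Complex.norm_eq_one_of_pow_eq_one ha hN) hB h⟩
  | zero => exact ⟨0, by simp⟩
  | add c d _ _ hc hd =>
    obtain ⟨B, h⟩ := hc
    obtain ⟨B', h'⟩ := hd
    exact ⟨B + B', fun n => by
      rw [add_mul]; exact (norm_add_le _ _).trans (add_le_add (h n) (h' n))⟩
  | smul q c _ hc =>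
    obtain ⟨B, h⟩ := hc
    refine ⟨‖(q : ℝ)‖ * B, fun n => ?_⟩
    rw [Pi.smul_apply, mul_assoc, Rat.smul_def, norm_mul]
    exact mul_le_mul (by rw [Complex.norm_ratCast, Real.norm_eq_abs]) (h n)
      (norm_nonneg _) (norm_nonneg _)

lemma polylogSpan_succ_zero {N w : ℕ} {c : ℕ → ℂ} (hc : c ∈ polylogSpan N (w + 1)) : c 0 = 0 := by
  induction hc using Submodule.span_induction with
  | mem c hc =>
    obtain ⟨L, hL, hw, rfl⟩ := hc
    obtain ⟨⟨k, a⟩, L, rfl⟩ := exists_cons_of_weight_succ hw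
    exact polylogCoeff_cons_zero k a L
  | zero => rfl
  | add c d _ _ hc hd => simp [hc, hd]
  | smul q c _ hc => simp [hc]

lemma exists_norm_le_of_mem_polylogSpan {N w : ℕ} (hN : N ≠ 0) {c : ℕ → ℂ}
    (hc : c ∈ polylogSpan N w) : ∃ B : ℝ, ∀ n : ℕ, ‖c n‖ ≤ B := by
  rcases w with _ | w
  · induction hc using Submodule.span_induction with
    | mem c hc =>
      obtain ⟨L, hL, hw, rfl⟩ := hc
      obtain rfl : L = [] := by
        rcases L with _ | ⟨x, L⟩
        · rfl
        · have := (hL x (by simp)).1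
          simp only [List.map_cons, List.sum_cons] at hw
          lia
      refine ⟨1, fun n => ?_⟩
      rw [polylogCoeff]
      split_ifs <;> simp
    | zero => exact ⟨0, by simp⟩
    | add c d _ _ hc hd =>
      obtain ⟨B, h⟩ := hc
      obtain ⟨B', h'⟩ := hd
      exact ⟨B + B', fun n => (norm_add_le _ _).trans (add_le_add (h n) (h' n))⟩
    | smul q c _ hc =>
      obtain ⟨B, h⟩ := hc
      refine ⟨‖(q : ℝ)‖ * B, fun n => ?_⟩
      rw [Pi.smul_apply, Rat.smul_def, norm_mul]
      exact mul_le_mul (by rw [Complex.norm_ratCast, Real.norm_eq_abs]) (h n)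
        (norm_nonneg _) (norm_nonneg _)
  · obtain ⟨B, h⟩ := exists_norm_le_of_mem_polylogSpan_succ hN hc
    refine ⟨B, fun n => ?_⟩
    have hB : 0 ≤ B := by simpa using (norm_nonneg _).trans (h 1)
    refine (h n).trans (mul_le_of_le_one_right hB ?_)
    rcases Nat.eq_zero_or_pos n with rfl | hn
    · simp
    · exact inv_le_one_of_one_le₀ (Real.one_le_sqrt.2 (by exact_mod_cast hn))

/-- Integration of `dt / t`. -/
lemma div_mem_polylogSpan {N w : ℕ} {c : ℕ → ℂ} (hc : c ∈ polylogSpan N (w + 1)) :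
    (fun n => c n / n) ∈ polylogSpan N (w + 2) := by
  induction hc using Submodule.span_induction with
  | mem c hc =>
    obtain ⟨L, hL, hw, rfl⟩ := hc
    obtain ⟨⟨k, a⟩, L, rfl⟩ := exists_cons_of_weight_succ hw
    refine Submodule.subset_span ⟨(k + 1, a) :: L, ?_, ?_, ?_⟩
    · intro y hy
      rcases List.mem_cons.1 hy with rfl | hy
      · exact ⟨by simp, (hL (k, a) (by simp)).2⟩
      · exact hL y (by simp [hy])
    · simp only [List.map_cons, List.sum_cons] at hw ⊢
      lia
    · funext n
      rw [polylogCoeff_succ_exponent]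
  | zero => convert! Submodule.zero_mem (polylogSpan N (w + 2)) using 1; funext n; simp
  | add c d _ _ hc hd => simpa [add_div, Pi.add_def] using Submodule.add_mem _ hc hd
  | smul q c _ hc =>
    convert! Submodule.smul_mem _ q hc using 1
    funext n
    simp [Rat.smul_def, mul_div_assoc]

/-- Integration of `a dt / (1 - a t)`. -/
lemma sum_div_mem_polylogSpan {N w : ℕ} {a : ℂ} (ha : a ^ N = 1) {c : ℕ → ℂ}
    (hc : c ∈ polylogSpan N w) :
    (fun n => (∑ l ∈ Finset.range n, a ^ (n - l) * c l) / n) ∈ polylogSpan N (w + 1) := by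
  induction hc using Submodule.span_induction with
  | mem c hc =>
    obtain ⟨L, hL, hw, rfl⟩ := hc
    refine Submodule.subset_span ⟨(1, a) :: L, ?_, ?_, ?_⟩
    · intro y hy
      rcases List.mem_cons.1 hy with rfl | hy
      · exact ⟨le_rfl, ha⟩
      · exact hL y hy
    · simp only [List.map_cons, List.sum_cons]
      lia
    · funext n
      simp [polylogCoeff]
  | zero => convert! Submodule.zero_mem (polylogSpan N (w + 1)) using 1; funext n; simp
  | add c d _ _ hc hd =>
    convert! Submodule.add_mem _ hc hd using 1
    funext n
    simp [mul_add, Finset.sum_add_distrib, add_div]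
  | smul q c _ hc =>
    convert! Submodule.smul_mem _ q hc using 1
    funext n
    simp only [Pi.smul_apply, Rat.smul_def, ← mul_div_assoc, Finset.mul_sum]
    congr 1
    exact Finset.sum_congr rfl fun j _ => by ring

lemma summable_norm_div_of_mem_polylogSpan {N w : ℕ} (hN : N ≠ 0) {c : ℕ → ℂ}
    (hc : c ∈ polylogSpan N (w + 1)) : Summable fun n : ℕ => ‖c n / n‖ := by
  obtain ⟨B, h⟩ := exists_norm_le_of_mem_polylogSpan_succ hN hc
  have hs : Summable fun n : ℕ => B * (1 / (n : ℝ) ^ (3 / 2 : ℝ)) :=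
    (Real.summable_one_div_nat_rpow.2 (by norm_num)).mul_left B
  refine Summable.of_nonneg_of_le (fun n => norm_nonneg _) (fun n => ?_) hs
  rcases Nat.eq_zero_or_pos n with rfl | hn
  · simp
  have hn' : (0 : ℝ) < n := by exact_mod_cast hn
  rw [norm_div, Complex.norm_natCast, show (3 / 2 : ℝ) = 1 / 2 + 1 by norm_num,
    Real.rpow_add hn', Real.rpow_one, ← Real.sqrt_eq_rpow, div_le_iff₀ hn']
  refine (h n).trans (le_of_eq ?_)
  field_simp

/-- One more integration of `dt / t`, evaluated at `t = 1`, gives a colored multiple zeta value: its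
leading exponent is at least `2`, so the series converges absolutely. -/
lemma exists_hasSum_div_mem_CMZV {N w : ℕ} (hN : N ≠ 0) {c : ℕ → ℂ}
    (hc : c ∈ polylogSpan N (w + 1)) : ∃ z ∈ CMZV N (w + 2), HasSum (fun n : ℕ => c n / n) z := by
  refine ⟨∑' n : ℕ, c n / n, ?_, (summable_norm_div_of_mem_polylogSpan hN hc).of_norm.hasSum⟩
  induction hc using Submodule.span_induction with
  | mem c hc =>
    have hs := (summable_norm_div_of_mem_polylogSpan hN (Submodule.subset_span hc)).of_norm.hasSum
    obtain ⟨L, hL, hw, rfl⟩ := hc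
    obtain ⟨⟨k, a⟩, L, rfl⟩ := exists_cons_of_weight_succ hw
    have hL' : ∀ y ∈ (k + 1, a) :: L, 1 ≤ y.1 ∧ y.2 ^ N = 1 := by
      intro y hy
      rcases List.mem_cons.1 hy with rfl | hy
      · exact ⟨by simp, (hL (k, a) (by simp)).2⟩
      · exact hL y (by simp [hy])
    refine Submodule.subset_span
      ⟨letterRatios 1 ((k + 1, a) :: L), by simp [letterRatios],
        letterRatios_valid _ 1 (one_pow N) hL', ?_, ?_, ?_⟩
    · have := (hL (k, a) (by simp)).1
      simp only [letterRatios, List.head?_cons, ne_eq, Option.some.injEq, Prod.mk.injEq, not_and]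
      lia
    · rw [map_fst_letterRatios]
      simp only [List.map_cons, List.sum_cons] at hw ⊢
      lia
    · refine ((tendsto_add_atTop_iff_nat 1).2 hs.tendsto_sum_nat).congr fun M => ?_
      have h0 : ∀ y ∈ (k + 1, a) :: L, y.2 ≠ 0 := by
        intro y hy h
        simpa [h, hN] using (hL' y hy).2
      have := sum_inv_pow_mul_polylogCoeff ((k + 1, a) :: L) 1 one_ne_zero h0 (M + 1) (by lia)
      simpa [polylogCoeff_succ_exponent] using this
  | zero => simp
  | add c d hc' hd' hc hd =>
    have h1 := (summable_norm_div_of_mem_polylogSpan hN hc').of_norm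
    have h2 := (summable_norm_div_of_mem_polylogSpan hN hd').of_norm
    simpa only [Pi.add_apply, add_div, h1.tsum_add h2] using Submodule.add_mem _ hc hd
  | smul q c _ hc =>
    have := Submodule.smul_mem _ q hc
    simpa only [Pi.smul_apply, Rat.smul_def, mul_div_assoc, tsum_mul_left] using this

/-! ### Differentiation of power series with coefficients of polynomial growth -/

lemma summable_add_two_pow_mul_geometric (d : ℕ) {r : ℝ} (h0 : 0 < r) (h1 : r < 1) :
    Summable fun n : ℕ => ((n : ℝ) + 2) ^ d * r ^ n := by
  have h := (summable_nat_add_iff 2).2 (summable_pow_mul_geometric_of_norm_lt_one (R := ℝ) d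
    (r := r) (by rwa [Real.norm_eq_abs, abs_of_pos h0]))
  refine (h.mul_right (r ^ 2)⁻¹).congr fun n => ?_
  push_cast
  rw [pow_add]
  field_simp

section PowerSeries

variable {𝕜 : Type*} [RCLike 𝕜] {c : ℕ → 𝕜} {B : ℝ} {d : ℕ}

lemma summable_norm_mul_pow_of_le (hc : ∀ n : ℕ, ‖c n‖ ≤ B * ((n : ℝ) + 1) ^ d) {x : 𝕜}
    (hx : ‖x‖ < 1) : Summable fun n : ℕ => ‖c n * x ^ n‖ := by
  obtain ⟨r, hr, hr1⟩ := exists_between hx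
  have hr0 : 0 < r := (norm_nonneg x).trans_lt hr
  have hB : 0 ≤ B := by simpa using (norm_nonneg _).trans (hc 0)
  refine Summable.of_nonneg_of_le (fun n => norm_nonneg _) (fun n => ?_)
    ((summable_add_two_pow_mul_geometric d hr0 hr1).mul_left B)
  rw [norm_mul, norm_pow, ← mul_assoc]
  refine mul_le_mul ((hc n).trans ?_) (pow_le_pow_left₀ (norm_nonneg _) hr.le n)
    (by positivity) (by positivity)
  gcongr
  norm_num

lemma norm_succ_mul_le (hc : ∀ n : ℕ, ‖c n‖ ≤ B * ((n : ℝ) + 1) ^ d) (n : ℕ) :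
    ‖((n : 𝕜) + 1) * c (n + 1)‖ ≤ B * 2 ^ d * ((n : ℝ) + 1) ^ (d + 1) := by
  have hB : 0 ≤ B := by simpa using (norm_nonneg _).trans (hc 0)
  have h1 : ‖(n : 𝕜) + 1‖ = n + 1 := by
    rw [← Nat.cast_succ, RCLike.norm_natCast]; push_cast; rfl
  rw [norm_mul, h1]
  calc ((n : ℝ) + 1) * ‖c (n + 1)‖ ≤ ((n : ℝ) + 1) * (B * (2 * ((n : ℝ) + 1)) ^ d) := by
        gcongr
        refine (hc (n + 1)).trans ?_
        push_cast
        gcongr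
        linarith
    _ = _ := by rw [mul_pow]; ring

lemma hasDerivAt_tsum_mul_pow (hc : ∀ n : ℕ, ‖c n‖ ≤ B * ((n : ℝ) + 1) ^ d) {x : 𝕜}
    (hx : ‖x‖ < 1) : HasDerivAt (fun z => ∑' n : ℕ, c n * z ^ n)
      (∑' n : ℕ, ((n : 𝕜) + 1) * c (n + 1) * x ^ n) x := by
  obtain ⟨r, hr, hr1⟩ := exists_between hx
  have hr0 : 0 < r := (norm_nonneg x).trans_lt hr
  have hB : 0 ≤ B := by simpa using (norm_nonneg _).trans (hc 0)
  have hu : Summable fun n : ℕ => B * ((n : ℝ) + 1) ^ d * (n * r ^ (n - 1)) := by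
    rw [← summable_nat_add_iff 1]
    refine Summable.of_nonneg_of_le (fun n => by positivity) (fun n => ?_)
      ((summable_add_two_pow_mul_geometric (d + 1) hr0 hr1).mul_left B)
    push_cast
    calc B * ((n : ℝ) + 1 + 1) ^ d * (((n : ℝ) + 1) * r ^ n)
        = B * ((((n : ℝ) + 2) ^ d * ((n : ℝ) + 1)) * r ^ n) := by ring
      _ ≤ B * ((((n : ℝ) + 2) ^ d * ((n : ℝ) + 2)) * r ^ n) := by gcongr; norm_num
      _ = _ := by rw [pow_succ]
  have key := hasDerivAt_tsum_of_isPreconnected (g := fun n z => c n * z ^ n)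
    (g' := fun n z => c n * ((n : 𝕜) * z ^ (n - 1))) (y₀ := x) (y := x) hu
    (Metric.isOpen_ball (x := (0 : 𝕜)) (ε := r)) (convex_ball (0 : 𝕜) r).isPreconnected
    (fun n y _ => (hasDerivAt_pow n y).const_mul (c n)) (fun n y hy => ?_) (by simpa using hr)
    (summable_norm_mul_pow_of_le hc hx).of_norm (by simpa using hr)
  · convert! key using 1
    have hs : Summable fun n : ℕ => ((n : 𝕜) + 1) * c (n + 1) * x ^ n :=
      (summable_norm_mul_pow_of_le (norm_succ_mul_le hc) hx).of_norm
    have hs' : Summable fun n : ℕ => c n * ((n : 𝕜) * x ^ (n - 1)) := by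
      rw [← summable_nat_add_iff 1]
      refine hs.congr fun n => ?_
      push_cast [Nat.add_sub_cancel]
      ring
    rw [hs'.tsum_eq_zero_add]
    simp only [CharP.cast_eq_zero, zero_mul, mul_zero, zero_add]
    refine tsum_congr fun n => ?_
    push_cast [Nat.add_sub_cancel]
    ring
  · have hy' : ‖y‖ ≤ r := by simpa using (mem_ball_zero_iff.1 hy).le
    rw [norm_mul, norm_mul, norm_pow, RCLike.norm_natCast]
    gcongr
    exact hc n

/-- The Euler derivative `x f' = ∑ n c n x ^ n`. -/
lemma hasSum_nat_mul_mul_pow (hc : ∀ n : ℕ, ‖c n‖ ≤ B * ((n : ℝ) + 1) ^ d) {x : 𝕜}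
    (hx : ‖x‖ < 1) : HasSum (fun n : ℕ => (n : 𝕜) * c n * x ^ n)
      (x * ∑' n : ℕ, ((n : 𝕜) + 1) * c (n + 1) * x ^ n) := by
  have hs : Summable fun n : ℕ => ((n : 𝕜) + 1) * c (n + 1) * x ^ n :=
      (summable_norm_mul_pow_of_le (norm_succ_mul_le hc) hx).of_norm
  rw [← hasSum_nat_add_iff' 1]
  convert! hs.hasSum.mul_left x using 1
  · funext n
    push_cast
    ring
  · simp

end PowerSeries

lemma eqOn_Ico_of_hasDerivAt_eq {f g f' : ℝ → ℂ} (hf : ContinuousOn f (Ico 0 1))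
    (hg : ContinuousOn g (Ico 0 1)) (h0 : f 0 = g 0)
    (hf' : ∀ t ∈ Ioo (0 : ℝ) 1, HasDerivAt f (f' t) t)
    (hg' : ∀ t ∈ Ioo (0 : ℝ) 1, HasDerivAt g (f' t) t) : ∀ t ∈ Ico (0 : ℝ) 1, f t = g t := by
  intro t ht
  have hsub : Icc 0 t ⊆ Ico (0 : ℝ) 1 := fun s hs => ⟨hs.1, hs.2.trans_lt ht.2⟩
  have := intervalIntegral.integral_eq_sub_of_hasDerivAt_of_le (f := fun s => f s - g s)
    (f' := fun _ => (0 : ℂ)) ht.1 ((hf.sub hg).mono hsub)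
    (fun s hs => by
      have hs' : s ∈ Ioo (0 : ℝ) 1 := ⟨hs.1, hs.2.trans ht.2⟩
      simpa only [sub_self] using! (hf' s hs').sub (hg' s hs')) intervalIntegrable_const
  simp only [intervalIntegral.integral_zero, h0, sub_self, sub_zero] at this
  exact sub_eq_zero.1 this.symm

/-! ### Colored polylogarithms as functions on the unit interval -/

/-- Functions which on `[0, 1)` are rational combinations of polylogarithms of level `N` and weight
`w`. Values outside `[0, 1)` are unconstrained. -/
def polylogFun (N w : ℕ) : Submodule ℚ (ℝ → ℂ) where
  carrier := {f | ∃ c ∈ polylogSpan N w, ∀ t ∈ Ico (0 : ℝ) 1,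
    HasSum (fun n : ℕ => c n * (t : ℂ) ^ n) (f t)}
  zero_mem' := ⟨0, zero_mem _, fun t _ => by simp⟩
  add_mem' := by
    rintro f g ⟨c, hc, hf⟩ ⟨d, hd, hg⟩
    exact ⟨c + d, add_mem hc hd, fun t ht => by
      simpa [add_mul] using (hf t ht).add (hg t ht)⟩
  smul_mem' := by
    rintro q f ⟨c, hc, hf⟩
    exact ⟨q • c, Submodule.smul_mem _ q hc, fun t ht => by
      simpa [Rat.smul_def, mul_assoc] using (hf t ht).mul_left (q : ℂ)⟩

/-- The Euler derivatives `t f'(t)` of the functions `f` in `polylogFun N w`. -/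
def polylogEuler (N w : ℕ) : Submodule ℚ (ℝ → ℂ) where
  carrier := {f | ∃ c ∈ polylogSpan N w, ∀ t ∈ Ico (0 : ℝ) 1,
    HasSum (fun n : ℕ => (n : ℂ) * c n * (t : ℂ) ^ n) (f t)}
  zero_mem' := ⟨0, zero_mem _, fun t _ => by simp⟩
  add_mem' := by
    rintro f g ⟨c, hc, hf⟩ ⟨d, hd, hg⟩
    exact ⟨c + d, add_mem hc hd, fun t ht => by
      simpa [mul_add, add_mul] using (hf t ht).add (hg t ht)⟩
  smul_mem' := by
    rintro q f ⟨c, hc, hf⟩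
    exact ⟨q • c, Submodule.smul_mem _ q hc, fun t ht => by
      simpa [Rat.smul_def, mul_assoc, mul_left_comm] using (hf t ht).mul_left (q : ℂ)⟩

lemma norm_ofReal_lt_one {t : ℝ} (ht : t ∈ Ico (0 : ℝ) 1) : ‖(t : ℂ)‖ < 1 := by
  rw [Complex.norm_real, Real.norm_eq_abs, abs_of_nonneg ht.1]
  exact ht.2

/-- Membership in `polylogFun` is detected by the Euler derivative: this replaces iterated integrals
throughout. -/
lemma mem_polylogFun_of_hasDerivAt {N w : ℕ} (hN : N ≠ 0) {f h : ℝ → ℂ}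
    (hf : ContinuousOn f (Ico 0 1)) (hf0 : f 0 = 0)
    (hf' : ∀ t ∈ Ioo (0 : ℝ) 1, HasDerivAt f (h t / t) t) (hh : h ∈ polylogEuler N (w + 1)) :
    f ∈ polylogFun N (w + 1) := by
  obtain ⟨c, hc, hs⟩ := hh
  obtain ⟨B, hB⟩ := exists_norm_le_of_mem_polylogSpan hN hc
  have hB' : ∀ n : ℕ, ‖c n‖ ≤ B * ((n : ℝ) + 1) ^ 0 := by simpa using hB
  have hder : ∀ t ∈ Ico (0 : ℝ) 1, HasDerivAt (fun s : ℝ => ∑' n : ℕ, c n * (s : ℂ) ^ n)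
      (∑' n : ℕ, ((n : ℂ) + 1) * c (n + 1) * (t : ℂ) ^ n) t := fun t ht =>
    (hasDerivAt_tsum_mul_pow hB' (norm_ofReal_lt_one ht)).comp_ofReal
  refine ⟨c, hc, fun t ht => ?_⟩
  rw [eqOn_Ico_of_hasDerivAt_eq hf
    (fun s hs => (hder s hs).continuousAt.continuousWithinAt) ?_ hf' (fun s hs' => ?_) t ht]
  · exact (summable_norm_mul_pow_of_le hB' (norm_ofReal_lt_one ht)).of_norm.hasSum
  · rw [hf0, tsum_eq_single 0 (fun n hn => by simp [hn]), polylogSpan_succ_zero hc, zero_mul]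
  · have hs'' := Ioo_subset_Ico_self hs'
    have hne : (s : ℂ) ≠ 0 := by exact_mod_cast hs'.1.ne'
    rw [(hs s hs'').unique (hasSum_nat_mul_mul_pow hB' (norm_ofReal_lt_one hs'')),
      mul_div_cancel_left₀ _ hne]
    exact hder s hs''

/-- Integration of `f(t) dt / t`. -/
lemma mem_polylogEuler_of_mem_polylogFun {N w : ℕ} {f : ℝ → ℂ} (hf : f ∈ polylogFun N (w + 1)) :
    f ∈ polylogEuler N (w + 2) := by
  obtain ⟨c, hc, hs⟩ := hf
  refine ⟨_, div_mem_polylogSpan hc, fun t ht => ?_⟩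
  convert! hs t ht using 2 with n
  rcases Nat.eq_zero_or_pos n with rfl | hn
  · simp [polylogSpan_succ_zero hc]
  · have : (n : ℂ) ≠ 0 := by exact_mod_cast hn.ne'
    field_simp

/-- Integration of `f(t) a dt / (1 - a t)`. -/
lemma letter_mul_mem_polylogEuler {N w : ℕ} (hN : N ≠ 0) {a : ℂ} (ha : a ^ N = 1) {f : ℝ → ℂ}
    (hf : f ∈ polylogFun N w) :
    (fun t : ℝ => a * t / (1 - a * t) * f t) ∈ polylogEuler N (w + 1) := by
  obtain ⟨c, hc, hs⟩ := hf
  obtain ⟨B, hB⟩ := exists_norm_le_of_mem_polylogSpan hN hc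
  have hB' : ∀ n : ℕ, ‖c n‖ ≤ B * ((n : ℝ) + 1) ^ 0 := by simpa using hB
  refine ⟨_, sum_div_mem_polylogSpan ha hc, fun t ht => ?_⟩
  have hna : ‖a * t‖ < 1 := by
    rw [norm_mul, Complex.norm_eq_one_of_pow_eq_one ha hN, one_mul]
    exact norm_ofReal_lt_one ht
  let g : ℕ → ℂ := fun j => if j = 0 then 0 else (a * t) ^ j
  have hg : HasSum g (a * t / (1 - a * t)) := by
    rw [← hasSum_nat_add_iff' 1]
    have := (hasSum_geometric_of_norm_lt_one hna).mul_left (a * t)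
    simpa [g, pow_succ', div_eq_mul_inv] using this
  have hgn : Summable fun j => ‖g j‖ := by
    refine Summable.of_nonneg_of_le (fun _ => norm_nonneg _) (fun j => ?_)
      (summable_geometric_of_lt_one (norm_nonneg _) hna)
    by_cases hj : j = 0
    · simp [g, hj]
    · simp [g, hj]
  have key := hasSum_sum_range_mul_of_summable_norm
    (summable_norm_mul_pow_of_le hB' (norm_ofReal_lt_one ht)) hgn
  rw [(hs t ht).tsum_eq, hg.tsum_eq, mul_comm] at key
  convert! key using 2 with n
  rw [Finset.sum_range_succ]
  rcases Nat.eq_zero_or_pos n with rfl | hn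
  · simp [g]
  have : (n : ℂ) ≠ 0 := by exact_mod_cast hn.ne'
  rw [mul_div_cancel₀ _ this, Finset.sum_mul]
  simp only [g, Nat.sub_self, if_true, mul_zero, add_zero]
  refine Finset.sum_congr rfl fun l hl => ?_
  rw [Finset.mem_range] at hl
  rw [if_neg (by lia), mul_pow]
  have : (t : ℂ) ^ n = t ^ l * t ^ (n - l) := by rw [← pow_add]; congr 1; lia
  rw [this]
  ring

lemma one_mem_polylogFun (N : ℕ) : (fun _ => 1 : ℝ → ℂ) ∈ polylogFun N 0 := by
  refine ⟨polylogCoeff [], Submodule.subset_span ⟨[], by simp, by simp, rfl⟩, fun t _ => ?_⟩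
  convert! hasSum_ite_eq (0 : ℕ) (1 : ℂ) using 2 with n
  by_cases hn : n = 0 <;> simp [polylogCoeff, hn]

lemma integral_pow_sub_one (n : ℕ) (hn : n ≠ 0) :
    ∫ t in Ioo (0 : ℝ) 1, t ^ (n - 1) = 1 / n := by
  rw [← integral_Ioc_eq_integral_Ioo, ← intervalIntegral.integral_of_le zero_le_one, integral_pow]
  obtain ⟨n, rfl⟩ := Nat.exists_eq_succ_of_ne_zero hn
  simp

lemma integrable_of_hasSum {α : Type*} {m : MeasurableSpace α} {μ : Measure α} {F : ℕ → α → ℂ}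
    {f : α → ℂ} (hF : ∀ n, Integrable (F n) μ) (hs : Summable fun n => ∫ a, ‖F n a‖ ∂μ)
    (hf : ∀ᵐ a ∂μ, HasSum (fun n => F n a) (f a)) : Integrable f μ := by
  refine ⟨aestronglyMeasurable_of_tendsto_ae atTop (fun n => Finset.aestronglyMeasurable_fun_sum
    (Finset.range n) fun i _ => (hF i).1) (hf.mono fun a ha => ha.tendsto_sum_nat), ?_⟩
  calc ∫⁻ a, ‖f a‖ₑ ∂μ ≤ ∫⁻ a, ∑' n, ‖F n a‖ₑ ∂μ :=
        lintegral_mono_ae (hf.mono fun a ha => ha.tsum_eq ▸ enorm_tsum_le_tsum_enorm)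
    _ = ∑' n, ENNReal.ofReal (∫ a, ‖F n a‖ ∂μ) := by
        rw [lintegral_tsum fun n => (hF n).1.enorm]
        exact tsum_congr fun n => (ofReal_integral_norm_eq_lintegral_enorm (hF n)).symm
    _ < ⊤ := hs.tsum_ofReal_lt_top

/-- Integrating `f(t) dt / t` over the whole interval leads to colored multiple zeta values. -/
lemma integral_div_mem_CMZV {N w : ℕ} (hN : N ≠ 0) {f : ℝ → ℂ} (hf : f ∈ polylogFun N (w + 1)) :
    IntegrableOn (fun t : ℝ => f t / t) (Ioo 0 1) ∧
      ∫ t in Ioo (0 : ℝ) 1, f t / t ∈ CMZV N (w + 2) := by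
  obtain ⟨c, hc, hs⟩ := hf
  have hsum := summable_norm_div_of_mem_polylogSpan hN hc
  obtain ⟨z, hz, hcz⟩ := exists_hasSum_div_mem_CMZV hN hc
  let F : ℕ → ℝ → ℂ := fun n t => c n * ((t ^ (n - 1) : ℝ) : ℂ)
  have hFi : ∀ n, IntegrableOn (F n) (Ioo 0 1) := fun n => by
    have : Continuous (F n) := by fun_prop
    exact (this.integrableOn_Icc (a := 0) (b := 1)).mono_set Ioo_subset_Icc_self
  have hFn : ∀ n, ∫ t in Ioo (0 : ℝ) 1, ‖F n t‖ = ‖c n / n‖ := by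
    intro n
    by_cases hn : n = 0
    · simp [F, hn, polylogSpan_succ_zero hc]
    rw [norm_div, Complex.norm_natCast, div_eq_mul_one_div, ← integral_pow_sub_one n hn,
      ← integral_const_mul]
    refine setIntegral_congr_fun measurableSet_Ioo fun t ht => ?_
    simp only [F]
    rw [norm_mul, Complex.norm_real, Real.norm_of_nonneg (pow_nonneg ht.1.le _)]
  have hF : ∀ n, ∫ t in Ioo (0 : ℝ) 1, F n t = c n / n := by
    intro n
    by_cases hn : n = 0
    · simp [F, hn, polylogSpan_succ_zero hc]
    simp only [F]
    rw [integral_const_mul, integral_complex_ofReal, integral_pow_sub_one n hn]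
    push_cast
    ring
  have hFs : ∀ t ∈ Ioo (0 : ℝ) 1, HasSum (fun n => F n t) (f t / t) := by
    intro t ht
    have hne : (t : ℂ) ≠ 0 := by exact_mod_cast ht.1.ne'
    convert! (hs t (Ioo_subset_Ico_self ht)).div_const (t : ℂ) using 2 with n
    by_cases hn : n = 0
    · simp [F, hn, polylogSpan_succ_zero hc]
    · obtain ⟨n, rfl⟩ := Nat.exists_eq_succ_of_ne_zero hn
      simp only [F, Nat.succ_eq_add_one, Nat.add_sub_cancel]
      push_cast
      rw [eq_div_iff hne]
      ring
  have hFsum : Summable fun n => ∫ t in Ioo (0 : ℝ) 1, ‖F n t‖ := by simpa only [hFn] using hsum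
  have heq : EqOn (fun t => ∑' n, F n t) (fun t : ℝ => f t / t) (Ioo 0 1) := fun t ht =>
    (hFs t ht).tsum_eq
  refine ⟨?_, ?_⟩
  · exact integrable_of_hasSum hFi hFsum
      ((ae_restrict_iff' measurableSet_Ioo).2 (Eventually.of_forall hFs))
  · have h := hasSum_integral_of_summable_integral_norm hFi hFsum
    rw [setIntegral_congr_fun measurableSet_Ioo heq] at h
    simp only [hF] at h
    rwa [h.unique hcz]

/-! ### The Taylor coefficients of powers of the arcsine -/

/-- The Taylor coefficients of `arcsin x ^ q / q!`, defined by the recursion which expresses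
`((1 - x²) ∂² - x ∂) (arcsin x ^ q / q!) = arcsin x ^ (q - 2) / (q - 2)!`. -/
noncomputable def arcsinPowCoeff (q : ℕ) : ℕ → ℝ
  | 0 => if q = 0 then 1 else 0
  | 1 => if q = 1 then 1 else 0
  | n + 2 => ((n : ℝ) ^ 2 * arcsinPowCoeff q n +
      if 2 ≤ q then arcsinPowCoeff (q - 2) n else 0) / (((n : ℝ) + 1) * ((n : ℝ) + 2))

lemma arcsinPowCoeff_nonneg_le_one (n : ℕ) :
    ∀ q, 0 ≤ arcsinPowCoeff q n ∧ arcsinPowCoeff q n ≤ 1 := by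
  induction n using Nat.twoStepInduction with
  | zero => intro q; rw [arcsinPowCoeff]; split_ifs <;> simp
  | one => intro q; rw [arcsinPowCoeff]; split_ifs <;> simp
  | more n ih _ =>
    intro q
    obtain ⟨h0, h1⟩ := ih q
    have h2 : 0 ≤ (if 2 ≤ q then arcsinPowCoeff (q - 2) n else 0) ∧
        (if 2 ≤ q then arcsinPowCoeff (q - 2) n else 0) ≤ 1 := by
      split_ifs
      · exact ih (q - 2)
      · simp
    rw [arcsinPowCoeff]
    refine ⟨div_nonneg (add_nonneg (by positivity) h2.1) (by positivity), ?_⟩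
    rw [div_le_one (by positivity)]
    have : (n : ℝ) ^ 2 * arcsinPowCoeff q n ≤ (n : ℝ) ^ 2 :=
      mul_le_of_le_one_right (by positivity) h1
    nlinarith [h2.2, (Nat.cast_nonneg n : (0 : ℝ) ≤ n)]

lemma eqOn_Ioo_of_hasDerivAt {a b z : ℝ} {f g f' : ℝ → ℝ} (hz : z ∈ Ioo a b)
    (hf : ∀ x ∈ Ioo a b, HasDerivAt f (f' x) x) (hg : ∀ x ∈ Ioo a b, HasDerivAt g (f' x) x)
    (hfg : f z = g z) : ∀ x ∈ Ioo a b, f x = g x :=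
  isOpen_Ioo.eqOn_of_deriv_eq isPreconnected_Ioo
    (fun x hx => (hf x hx).differentiableAt.differentiableWithinAt)
    (fun x hx => (hg x hx).differentiableAt.differentiableWithinAt)
    (fun x hx => (hf x hx).deriv.trans (hg x hx).deriv.symm) hz hfg

/-- A power series whose coefficients satisfy the recursion attached to `(1 - x²) ∂² - x ∂` is
determined by a pair of functions solving `√(1 - x²) A' = B`, `√(1 - x²) B' = G`. -/
lemma hasSum_of_arcsin_recurrence {c g : ℕ → ℝ} {A B G : ℝ → ℝ} {K : ℝ} (hc : ∀ n, ‖c n‖ ≤ K)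
    (hrec : ∀ n : ℕ, ((n : ℝ) + 1) * ((n : ℝ) + 2) * c (n + 2) = (n : ℝ) ^ 2 * c n + g n)
    (hG : ∀ x ∈ Ioo (-1 : ℝ) 1, HasSum (fun n => g n * x ^ n) (G x))
    (hA : ∀ x ∈ Ioo (-1 : ℝ) 1, HasDerivAt A (B x / √(1 - x ^ 2)) x)
    (hB : ∀ x ∈ Ioo (-1 : ℝ) 1, HasDerivAt B (G x / √(1 - x ^ 2)) x)
    (hA0 : A 0 = c 0) (hB0 : B 0 = c 1) {x : ℝ} (hx : x ∈ Ioo (-1 : ℝ) 1) :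
    HasSum (fun n => c n * x ^ n) (A x) := by
  have hc' : ∀ n : ℕ, ‖c n‖ ≤ K * ((n : ℝ) + 1) ^ 0 := by simpa using hc
  have hnorm : ∀ {x : ℝ}, x ∈ Ioo (-1 : ℝ) 1 → ‖x‖ < 1 := fun hx => abs_lt.2 hx
  have h0 : (0 : ℝ) ∈ Ioo (-1 : ℝ) 1 := by norm_num
  set c₁ : ℕ → ℝ := fun n => ((n : ℝ) + 1) * c (n + 1) with hc₁
  have hc₁' : ∀ n : ℕ, ‖c₁ n‖ ≤ K * 2 ^ 0 * ((n : ℝ) + 1) ^ (0 + 1) := norm_succ_mul_le hc'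
  set c₂ : ℕ → ℝ := fun n => ((n : ℝ) + 1) * c₁ (n + 1) with hc₂
  have hc₂' := norm_succ_mul_le hc₁'
  set f₀ : ℝ → ℝ := fun x => ∑' n, c n * x ^ n
  set f₁ : ℝ → ℝ := fun x => ∑' n, c₁ n * x ^ n
  set f₂ : ℝ → ℝ := fun x => ∑' n, c₂ n * x ^ n
  have hf₀ : ∀ x ∈ Ioo (-1 : ℝ) 1, HasDerivAt f₀ (f₁ x) x := fun x hx =>
    hasDerivAt_tsum_mul_pow hc' (hnorm hx)
  have hf₁ : ∀ x ∈ Ioo (-1 : ℝ) 1, HasDerivAt f₁ (f₂ x) x := fun x hx =>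
    hasDerivAt_tsum_mul_pow hc₁' (hnorm hx)
  have hode : ∀ x ∈ Ioo (-1 : ℝ) 1, (1 - x ^ 2) * f₂ x - x * f₁ x = G x := by
    intro x hx
    have s₂ : HasSum (fun n => c₂ n * x ^ n) (f₂ x) :=
      (summable_norm_mul_pow_of_le hc₂' (hnorm hx)).of_norm.hasSum
    have s₁ : HasSum (fun n => c₁ n * x ^ n) (f₁ x) :=
      (summable_norm_mul_pow_of_le hc₁' (hnorm hx)).of_norm.hasSum
    have s₃ : HasSum (fun n : ℕ => (n : ℝ) ^ 2 * c n * x ^ n) (x * (x * f₂ x + f₁ x)) := by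
      have := ((hasSum_nat_mul_mul_pow hc₁' (hnorm hx)).add s₁).mul_left x
      rw [← hasSum_nat_add_iff' 1]
      convert! this using 1
      · funext n
        simp only [hc₁]
        push_cast
        ring
      · simp [f₂, hc₂]
    have := (s₂.sub s₃).unique ((hG x hx).congr_fun fun n => ?_)
    · rw [← this]; ring
    · have := hrec n
      simp only [hc₂, hc₁]
      push_cast
      linear_combination x ^ n * this
  have hpos : ∀ x ∈ Ioo (-1 : ℝ) 1, 0 < 1 - x ^ 2 := fun x hx => by nlinarith [hx.1, hx.2]
  have hone : ∀ x ∈ Ioo (-1 : ℝ) 1, f₁ x * √(1 - x ^ 2) = B x := by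
    -- the differential equation says exactly that `√(1 - x²) f₁` has the same derivative as `B`
    refine eqOn_Ioo_of_hasDerivAt h0 (fun x hx => ?_) hB ?_
    · have hx' := hpos x hx
      have hsq : √(1 - x ^ 2) ^ 2 = 1 - x ^ 2 := Real.sq_sqrt hx'.le
      have hs0 : √(1 - x ^ 2) ≠ 0 := (Real.sqrt_pos.2 hx').ne'
      convert! (hf₁ x hx).mul (((hasDerivAt_pow 2 x).const_sub 1).sqrt hx'.ne') using 1
      rw [← hode x hx]
      field_simp
      rw [hsq]
      ring
    · rw [hB0]
      simp only [f₁]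
      rw [tsum_eq_single 0 fun n hn => by simp [hn]]
      simp [hc₁]
  have htwo : ∀ x ∈ Ioo (-1 : ℝ) 1, f₀ x = A x := by
    refine eqOn_Ioo_of_hasDerivAt h0 (fun x hx => ?_) hA ?_
    · rw [← hone x hx, mul_div_cancel_right₀ _ (Real.sqrt_pos.2 (hpos x hx)).ne']
      exact hf₀ x hx
    · rw [hA0]
      simp only [f₀]
      rw [tsum_eq_single 0 fun n hn => by simp [hn]]
      simp
  rw [← htwo x hx]
  exact (summable_norm_mul_pow_of_le hc' (hnorm hx)).of_norm.hasSum

/-- The Taylor expansion of `arcsin x ^ q / q!`. -/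
lemma hasSum_arcsin_pow (q : ℕ) : ∀ {x : ℝ}, x ∈ Ioo (-1 : ℝ) 1 →
    HasSum (fun n => arcsinPowCoeff q n * x ^ n) (Real.arcsin x ^ q / q.factorial) := by
  have hb : ∀ q n, ‖arcsinPowCoeff q n‖ ≤ 1 := fun q n => by
    obtain ⟨h0, h1⟩ := arcsinPowCoeff_nonneg_le_one n q
    rwa [Real.norm_of_nonneg h0]
  have hrec : ∀ q n : ℕ, ((n : ℝ) + 1) * ((n : ℝ) + 2) * arcsinPowCoeff q (n + 2) =
      (n : ℝ) ^ 2 * arcsinPowCoeff q n + if 2 ≤ q then arcsinPowCoeff (q - 2) n else 0 := by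
    intro q n
    rw [arcsinPowCoeff]
    field_simp
  have hd : ∀ (q : ℕ) (x : ℝ), x ∈ Ioo (-1 : ℝ) 1 →
      HasDerivAt (fun x => Real.arcsin x ^ (q + 1) / (q + 1).factorial)
        (Real.arcsin x ^ q / q.factorial / √(1 - x ^ 2)) x := by
    intro q x hx
    convert! ((Real.hasDerivAt_arcsin hx.1.ne' hx.2.ne).pow (q + 1)).div_const _ using 1
    rw [Nat.factorial_succ]
    push_cast [Nat.add_sub_cancel]
    field_simp
  induction q using Nat.twoStepInduction with
  | zero =>
    intro x hx
    refine hasSum_of_arcsin_recurrence (A := fun x => Real.arcsin x ^ 0 / (Nat.factorial 0))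
      (B := fun _ => 0) (G := fun _ => 0) (g := fun _ => 0) (hb 0)
      (by simpa using hrec 0) (by simp) (fun x hx => ?_) (fun x hx => ?_) ?_ ?_ hx
    · simpa using hasDerivAt_const x (1 : ℝ)
    · simpa using hasDerivAt_const x (0 : ℝ)
    · simp [arcsinPowCoeff]
    · simp [arcsinPowCoeff]
  | one =>
    intro x hx
    refine hasSum_of_arcsin_recurrence (A := fun x => Real.arcsin x ^ 1 / (Nat.factorial 1))
      (B := fun _ => 1) (G := fun _ => 0) (g := fun _ => 0) (hb 1)
      (by simpa using hrec 1) (by simp) (fun x hx => ?_) (fun x hx => ?_) ?_ ?_ hx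
    · simpa using hd 0 x hx
    · simpa using hasDerivAt_const x (1 : ℝ)
    · simp [arcsinPowCoeff]
    · simp [arcsinPowCoeff]
  | more q ih _ =>
    intro x hx
    refine hasSum_of_arcsin_recurrence (g := arcsinPowCoeff q) (hb (q + 2))
      (by simpa using hrec (q + 2)) (fun x hx => ih hx) (hd (q + 1)) (hd q) ?_ ?_ hx
    · simp [arcsinPowCoeff]
    · simp [arcsinPowCoeff]

/-! ### Arcsine coefficients as multiple harmonic sums -/

lemma arcsinPowCoeff_parity (n : ℕ) : ∀ p, arcsinPowCoeff (2 * p) (2 * n + 1) = 0 ∧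
    arcsinPowCoeff (2 * p + 1) (2 * n) = 0 := by
  induction n with
  | zero =>
    intro p
    simp [arcsinPowCoeff]
  | succ n ih =>
    intro p
    rw [show 2 * (n + 1) + 1 = 2 * n + 1 + 2 by ring, show 2 * (n + 1) = 2 * n + 2 by ring,
      arcsinPowCoeff, arcsinPowCoeff, (ih p).1, (ih p).2]
    refine ⟨?_, ?_⟩
    · split_ifs with h
      · rw [show 2 * p - 2 = 2 * (p - 1) by lia, (ih (p - 1)).1]
        simp
      · simp
    · split_ifs with h
      · rw [show 2 * p + 1 - 2 = 2 * (p - 1) + 1 by lia, (ih (p - 1)).2]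
        simp
      · simp

lemma nestedSum_succ {R : Type*} [Semiring R] (f : ℕ → R) (L : List (ℕ → R)) (n : ℕ) :
    nestedSum (f :: L) (n + 1) = nestedSum (f :: L) n + f (n + 1) * nestedSum L n := by
  simp [nestedSum, Finset.sum_Icc_succ_top]

lemma nestedStarSum_succ {R : Type*} [Semiring R] (f : ℕ → R) (L : List (ℕ → R)) (n : ℕ) :
    nestedStarSum (f :: L) (n + 1) =
      nestedStarSum (f :: L) n + f (n + 1) * nestedStarSum L (n + 1) := by
  simp [nestedStarSum, Finset.sum_Icc_succ_top]

lemma multipleTHarmonicSum_zero (p : ℕ) :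
    multipleTHarmonicSum 0 (List.replicate p 2) = if p = 0 then 1 else 0 := by
  rcases p with _ | p
  · simp [multipleTHarmonicSum, nestedSum]
  · simp [multipleTHarmonicSum, List.replicate_succ, nestedSum]

lemma multipleTHarmonicSum_succ (n p : ℕ) :
    multipleTHarmonicSum (n + 1) (List.replicate (p + 1) 2) =
      multipleTHarmonicSum n (List.replicate (p + 1) 2) +
        multipleTHarmonicSum n (List.replicate p 2) / (2 * n + 1) ^ 2 := by
  simp only [multipleTHarmonicSum, List.replicate_succ, List.map_cons, nestedSum_succ]
  push_cast
  rw [show 2 * ((n : ℝ) + 1) - 1 = 2 * n + 1 by ring]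
  ring

lemma multipleHarmonicSum_succ (n p : ℕ) :
    multipleHarmonicSum (n + 1) (List.replicate (p + 1) 2) =
      multipleHarmonicSum n (List.replicate (p + 1) 2) +
        multipleHarmonicSum n (List.replicate p 2) / (n + 1) ^ 2 := by
  simp only [multipleHarmonicSum, List.replicate_succ, List.map_cons, nestedSum_succ]
  push_cast
  ring

lemma multipleTHarmonicSum_eq_zero (n : ℕ) : ∀ p, n < p →
    multipleTHarmonicSum n (List.replicate p 2) = 0 := by
  induction n with
  | zero => intro p hp; rw [multipleTHarmonicSum_zero, if_neg hp.ne']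
  | succ n ih =>
    intro p hp
    obtain ⟨p, rfl⟩ : ∃ p', p = p' + 1 := ⟨p - 1, by lia⟩
    rw [multipleTHarmonicSum_succ, ih _ (by lia), ih _ (by lia)]
    simp

lemma multipleHarmonicSum_eq_zero (n : ℕ) : ∀ p, n < p →
    multipleHarmonicSum n (List.replicate p 2) = 0 := by
  induction n with
  | zero =>
    intro p hp
    obtain ⟨p, rfl⟩ : ∃ p', p = p' + 1 := ⟨p - 1, by lia⟩
    simp [multipleHarmonicSum, List.replicate_succ, nestedSum]
  | succ n ih =>
    intro p hp
    obtain ⟨p, rfl⟩ : ∃ p', p = p' + 1 := ⟨p - 1, by lia⟩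
    rw [multipleHarmonicSum_succ, ih _ (by lia), ih _ (by lia)]
    simp

/-- The normalized central binomial coefficient `binom(2n, n) / 4 ^ n`. -/
noncomputable def centralRatio (n : ℕ) : ℝ := ((2 * n).choose n : ℝ) / 4 ^ n

lemma centralRatio_pos (n : ℕ) : 0 < centralRatio n :=
  div_pos (by exact_mod_cast Nat.choose_pos (by lia)) (by positivity)

lemma centralRatio_zero : centralRatio 0 = 1 := by simp [centralRatio]

lemma centralRatio_succ (n : ℕ) :
    (2 * (n : ℝ) + 2) * centralRatio (n + 1) = (2 * n + 1) * centralRatio n := by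
  have h := Nat.succ_mul_centralBinom_succ n
  simp only [Nat.centralBinom] at h
  have h' : ((n : ℝ) + 1) * ((2 * (n + 1)).choose (n + 1) : ℝ) =
      2 * (2 * n + 1) * ((2 * n).choose n : ℝ) := by exact_mod_cast h
  simp only [centralRatio, pow_succ]
  field_simp
  linear_combination 2 * h'

lemma arcsinPowCoeff_odd (n : ℕ) : ∀ p, arcsinPowCoeff (2 * p + 1) (2 * n + 1) =
    centralRatio n * multipleTHarmonicSum n (List.replicate p 2) / (2 * n + 1) := by
  induction n with
  | zero =>
    intro p
    rw [arcsinPowCoeff, multipleTHarmonicSum_zero, centralRatio_zero]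
    by_cases hp : p = 0 <;> simp [hp]
  | succ n ih =>
    intro p
    have hb : centralRatio (n + 1) = (2 * n + 1) * centralRatio n / (2 * n + 2) := by
      rw [← centralRatio_succ]
      field_simp
    rw [show 2 * (n + 1) + 1 = 2 * n + 1 + 2 by ring, arcsinPowCoeff, ih p, hb]
    rcases p with _ | p
    · simp [multipleTHarmonicSum, nestedSum]
      field_simp
      ring
    · rw [if_pos (by lia), show 2 * (p + 1) + 1 - 2 = 2 * p + 1 by lia, ih p,
        multipleTHarmonicSum_succ]
      push_cast
      field_simp
      ring

lemma arcsinPowCoeff_even (n : ℕ) : ∀ p, arcsinPowCoeff (2 * (p + 1)) (2 * (n + 1)) =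
    multipleHarmonicSum n (List.replicate p 2) /
      (4 ^ (p + 1) * centralRatio (n + 1) * ((n : ℝ) + 1) ^ 2) := by
  induction n with
  | zero =>
    intro p
    have hb := centralRatio_succ 0
    rw [centralRatio_zero] at hb
    have hb' : centralRatio (0 + 1) = 1 / 2 := by push_cast at hb; linarith
    rw [hb', show 2 * (0 + 1) = 0 + 2 by ring, arcsinPowCoeff]
    rcases p with _ | p
    · simp [arcsinPowCoeff, multipleHarmonicSum, nestedSum]
      norm_num
    · rw [multipleHarmonicSum_eq_zero 0 _ (by lia)]
      simp [arcsinPowCoeff]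
      lia
  | succ n ih =>
    intro p
    have hb : centralRatio (n + 1 + 1) = (2 * n + 3) * centralRatio (n + 1) / (2 * n + 4) := by
      have := centralRatio_succ (n + 1)
      push_cast at this
      field_simp
      linear_combination this
    have hpos := (centralRatio_pos (n + 1)).ne'
    rw [show 2 * (n + 1 + 1) = 2 * (n + 1) + 2 by ring, arcsinPowCoeff, ih p, hb,
      if_pos (by lia), show 2 * (p + 1) - 2 = 2 * p by lia]
    rcases p with _ | p
    · have : arcsinPowCoeff 0 (2 * (n + 1)) = 0 := by
        have h : ∀ m, arcsinPowCoeff 0 (m + 1) = 0 := by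
          intro m
          induction m using Nat.twoStepInduction with
          | zero => simp [arcsinPowCoeff]
          | one => simp [arcsinPowCoeff]
          | more m ih _ => rw [arcsinPowCoeff, ih]; simp
        exact h (2 * n + 1)
      simp only [mul_zero, this, multipleHarmonicSum, nestedSum, List.replicate_zero, List.map_nil]
      push_cast
      field_simp
      ring
    · rw [ih p, multipleHarmonicSum_succ]
      push_cast
      field_simp
      ring

/-! ### The half-angle substitution -/

/-- `sin θ` as a function of `t = tan (θ / 2)`. -/
noncomputable def halfSin (t : ℝ) : ℝ := 2 * t / (1 + t ^ 2)

/-- `cos θ` as a function of `t = tan (θ / 2)`. -/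
noncomputable def halfCos (t : ℝ) : ℝ := (1 - t ^ 2) / (1 + t ^ 2)

/-- `-log (cos θ)` as a function of `t = tan (θ / 2)`. -/
noncomputable def negLogHalfCos (t : ℝ) : ℝ := -Real.log (halfCos t)

/-- The derivative of the divided power `x ^ n / n!`. -/
noncomputable def dividedPowDeriv (n : ℕ) (x : ℝ) : ℝ :=
  if n = 0 then 0 else x ^ (n - 1) / (n - 1).factorial

lemma hasDerivAt_dividedPow (n : ℕ) (x : ℝ) :
    HasDerivAt (fun x : ℝ => x ^ n / n.factorial) (dividedPowDeriv n x) x := by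
  convert! (hasDerivAt_pow n x).div_const _ using 1
  rcases n with _ | n
  · simp [dividedPowDeriv]
  · rw [dividedPowDeriv, if_neg (by lia), Nat.factorial_succ]
    push_cast [Nat.add_sub_cancel]
    field_simp

lemma halfSin_sq_add_halfCos_sq (t : ℝ) : halfSin t ^ 2 + halfCos t ^ 2 = 1 := by
  have : 1 + t ^ 2 ≠ 0 := by positivity
  rw [halfSin, halfCos]
  field_simp
  ring

lemma halfCos_pos {t : ℝ} (ht : t ∈ Ico (0 : ℝ) 1) : 0 < halfCos t :=
  div_pos (by nlinarith [ht.1, ht.2]) (by positivity)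

lemma halfCos_le_one (t : ℝ) : halfCos t ≤ 1 := by
  rw [halfCos, div_le_one (by positivity)]
  nlinarith [sq_nonneg t]

lemma halfSin_nonneg {t : ℝ} (ht : t ∈ Ico (0 : ℝ) 1) : 0 ≤ halfSin t :=
  div_nonneg (by linarith [ht.1]) (by positivity)

lemma halfSin_mem {t : ℝ} (ht : t ∈ Ico (0 : ℝ) 1) : halfSin t ∈ Ioo (-1 : ℝ) 1 := by
  refine ⟨by linarith [halfSin_nonneg ht], ?_⟩
  nlinarith [halfSin_nonneg ht, halfCos_pos ht, halfSin_sq_add_halfCos_sq t]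

lemma sqrt_one_sub_halfSin_sq {t : ℝ} (ht : t ∈ Ico (0 : ℝ) 1) :
    √(1 - halfSin t ^ 2) = halfCos t := by
  rw [← halfSin_sq_add_halfCos_sq t, add_sub_cancel_left, Real.sqrt_sq (halfCos_pos ht).le]

lemma negLogHalfCos_nonneg {t : ℝ} (ht : t ∈ Ico (0 : ℝ) 1) : 0 ≤ negLogHalfCos t :=
  neg_nonneg.2 (Real.log_nonpos (halfCos_pos ht).le (halfCos_le_one t))

lemma hasDerivAt_halfSin (t : ℝ) : HasDerivAt halfSin (2 / (1 + t ^ 2) * halfCos t) t := by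
  have h : 1 + t ^ 2 ≠ 0 := by positivity
  convert! ((hasDerivAt_id t).const_mul 2).div ((hasDerivAt_pow 2 t).const_add 1) h using 1
  rw [halfCos]
  simp only [id]
  field_simp
  push_cast
  ring

lemma hasDerivAt_halfCos (t : ℝ) : HasDerivAt halfCos (-(2 / (1 + t ^ 2) * halfSin t)) t := by
  have h : 1 + t ^ 2 ≠ 0 := by positivity
  convert! ((hasDerivAt_pow 2 t).const_sub 1).div ((hasDerivAt_pow 2 t).const_add 1) h using 1
  rw [halfSin]
  field_simp
  push_cast
  ring

lemma hasDerivAt_negLogHalfCos {t : ℝ} (ht : t ∈ Ico (0 : ℝ) 1) :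
    HasDerivAt negLogHalfCos (2 / (1 + t ^ 2) * halfSin t / halfCos t) t := by
  convert! ((hasDerivAt_halfCos t).log (halfCos_pos ht).ne').neg using 1
  ring

lemma hasDerivAt_arcsin_halfSin {t : ℝ} (ht : t ∈ Ico (0 : ℝ) 1) :
    HasDerivAt (fun t => Real.arcsin (halfSin t)) (2 / (1 + t ^ 2)) t := by
  have hx := halfSin_mem ht
  convert! (Real.hasDerivAt_arcsin hx.1.ne' hx.2.ne).comp t (hasDerivAt_halfSin t) using 1
  rw [sqrt_one_sub_halfSin_sq ht]
  have := (halfCos_pos ht).ne'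
  field_simp

/-! ### Membership in the space of polylogarithms of level four -/

/-- The series `∑ c_n x ^ n / n ^ m`, where `c_n` are the Taylor coefficients of
`arcsin x ^ q / q!`. -/
noncomputable def arcsinPolylog (q m : ℕ) (x : ℝ) : ℝ :=
  ∑' n : ℕ, arcsinPowCoeff q n / (n : ℝ) ^ m * x ^ n

lemma norm_arcsinPowCoeff_div_le (q m n : ℕ) :
    ‖arcsinPowCoeff q n / (n : ℝ) ^ m‖ ≤ 1 * ((n : ℝ) + 1) ^ 0 := by
  obtain ⟨h0, h1⟩ := arcsinPowCoeff_nonneg_le_one n q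
  rw [norm_div, Real.norm_of_nonneg h0, norm_pow, Real.norm_natCast, pow_zero, mul_one]
  rcases Nat.eq_zero_or_pos n with rfl | hn
  · rcases m with _ | m <;> simp [h1]
  · refine div_le_one_of_le₀ (h1.trans (one_le_pow₀ (by exact_mod_cast hn))) (by positivity)

lemma hasSum_arcsinPolylog (q m : ℕ) {x : ℝ} (hx : x ∈ Ioo (-1 : ℝ) 1) :
    HasSum (fun n : ℕ => arcsinPowCoeff q n / (n : ℝ) ^ m * x ^ n) (arcsinPolylog q m x) :=
  (summable_norm_mul_pow_of_le (norm_arcsinPowCoeff_div_le q m) (abs_lt.2 hx)).of_norm.hasSum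

lemma arcsinPolylog_zero_right (q : ℕ) {x : ℝ} (hx : x ∈ Ioo (-1 : ℝ) 1) :
    arcsinPolylog q 0 x = Real.arcsin x ^ q / q.factorial :=
  (hasSum_arcsinPolylog q 0 hx).unique (by simpa using hasSum_arcsin_pow q hx)

lemma arcsinPowCoeff_zero_right {q : ℕ} (hq : q ≠ 0) : arcsinPowCoeff q 0 = 0 := by
  simp [arcsinPowCoeff, hq]

lemma arcsinPolylog_apply_zero {q : ℕ} (hq : q ≠ 0) (m : ℕ) : arcsinPolylog q m 0 = 0 := by
  rw [arcsinPolylog, tsum_eq_single 0 fun n hn => by simp [hn], arcsinPowCoeff_zero_right hq]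
  simp

lemma continuousAt_arcsinPolylog (q m : ℕ) {x : ℝ} (hx : x ∈ Ioo (-1 : ℝ) 1) :
    ContinuousAt (arcsinPolylog q m) x :=
  (hasDerivAt_tsum_mul_pow (norm_arcsinPowCoeff_div_le q m) (abs_lt.2 hx)).continuousAt

lemma hasDerivAt_arcsinPolylog {q : ℕ} (hq : q ≠ 0) (m : ℕ) {x : ℝ} (hx : x ∈ Ioo (0 : ℝ) 1) :
    HasDerivAt (arcsinPolylog q (m + 1)) (arcsinPolylog q m x / x) x := by
  have hx' : x ∈ Ioo (-1 : ℝ) 1 := ⟨by linarith [hx.1], hx.2⟩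
  convert! hasDerivAt_tsum_mul_pow (norm_arcsinPowCoeff_div_le q (m + 1)) (abs_lt.2 hx') using 1
  rw [div_eq_iff hx.1.ne', mul_comm]
  refine (hasSum_arcsinPolylog q m hx').unique ?_
  convert! hasSum_nat_mul_mul_pow (norm_arcsinPowCoeff_div_le q (m + 1)) (abs_lt.2 hx') using 2
    with n
  rcases Nat.eq_zero_or_pos n with rfl | hn
  · simp [arcsinPowCoeff_zero_right hq]
  · have : (n : ℝ) ≠ 0 := by exact_mod_cast hn.ne'
    rw [pow_succ]
    field_simp

/-- The functions to which the series of the theorem lead: `I ^ q` times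
`(-log cos θ) ^ k / k! * arcsinPolylog q m (sin θ)` with `t = tan (θ / 2)`. The factor `I ^ q`
accounts for `dθ = 2 dt / (1 + t²)` being `-I` times a rational combination of letters. -/
noncomputable def logArcsinPolylog (k q m : ℕ) (t : ℝ) : ℂ :=
  Complex.I ^ q * ((negLogHalfCos t ^ k / k.factorial * arcsinPolylog q m (halfSin t) : ℝ) : ℂ)

section Letters

variable {t : ℝ}

lemma one_sub_I_mul_ne_zero (t : ℝ) : 1 - Complex.I * t ≠ 0 ∧ 1 - -Complex.I * t ≠ 0 := by
  constructor <;> intro h <;> simpa using congrArg Complex.re h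

lemma letter_I_add (t : ℝ) : Complex.I * t / (1 - Complex.I * t) +
    -Complex.I * t / (1 - -Complex.I * t) = ((-(2 * t ^ 2 / (1 + t ^ 2)) : ℝ) : ℂ) := by
  obtain ⟨h1, h2⟩ := one_sub_I_mul_ne_zero t
  have h3 : (1 + t ^ 2 : ℂ) ≠ 0 := by
    have : (1 + t ^ 2 : ℝ) ≠ 0 := by positivity
    exact_mod_cast this
  push_cast
  rw [div_add_div _ _ h1 h2, ← neg_div, div_eq_div_iff (mul_ne_zero h1 h2) h3]
  linear_combination 2 * (t : ℂ) ^ 2 * Complex.I_sq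

lemma letter_I_sub (t : ℝ) : Complex.I * t / (1 - Complex.I * t) -
    -Complex.I * t / (1 - -Complex.I * t) = Complex.I * ((2 * t / (1 + t ^ 2) : ℝ) : ℂ) := by
  obtain ⟨h1, h2⟩ := one_sub_I_mul_ne_zero t
  have h3 : (1 + t ^ 2 : ℂ) ≠ 0 := by
    have : (1 + t ^ 2 : ℝ) ≠ 0 := by positivity
    exact_mod_cast this
  push_cast
  rw [div_sub_div _ _ h1 h2, ← mul_div_assoc, div_eq_div_iff (mul_ne_zero h1 h2) h3]
  linear_combination 2 * Complex.I * (t : ℂ) ^ 3 * Complex.I_sq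

lemma letter_one_add (ht : t ∈ Ioo (0 : ℝ) 1) : (1 : ℂ) * t / (1 - 1 * t) +
    -1 * t / (1 - -1 * t) = ((2 * t ^ 2 / (1 - t ^ 2) : ℝ) : ℂ) := by
  have h1 : (1 - t : ℝ) ≠ 0 := by linarith [ht.2]
  have h2 : (1 + t : ℝ) ≠ 0 := by linarith [ht.1]
  have h3 : (1 - t ^ 2 : ℝ) ≠ 0 := by nlinarith [ht.1, ht.2]
  have key : t / (1 - t) - t / (1 + t) = 2 * t ^ 2 / (1 - t ^ 2) := by
    field_simp
    ring
  rw [← key]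
  push_cast
  ring

end Letters

lemma continuousOn_logArcsinPolylog (k q m : ℕ) :
    ContinuousOn (logArcsinPolylog k q m) (Ico 0 1) := by
  intro t ht
  have h1 := (hasDerivAt_negLogHalfCos ht).continuousAt
  have h2 : ContinuousAt (fun t => arcsinPolylog q m (halfSin t)) t :=
    (continuousAt_arcsinPolylog q m (halfSin_mem ht)).comp (hasDerivAt_halfSin t).continuousAt
  have h3 : ContinuousAt (fun t => negLogHalfCos t ^ k / k.factorial *
    arcsinPolylog q m (halfSin t)) t := ((h1.pow k).div_const _).mul h2
  exact ((Complex.continuous_ofReal.continuousAt.comp h3).const_mul _).continuousWithinAt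

lemma logArcsinPolylog_apply_zero {k q m : ℕ} (h : k + q ≠ 0) :
    logArcsinPolylog k q m 0 = 0 := by
  have h0 : halfSin 0 = 0 := by simp [halfSin]
  have h1 : negLogHalfCos 0 = 0 := by simp [negLogHalfCos, halfCos]
  rw [logArcsinPolylog, h0, h1]
  by_cases hq : q = 0
  · have hk : k ≠ 0 := by lia
    simp [hk]
  · simp [arcsinPolylog_apply_zero hq]

lemma neg_I_pow_four : (-Complex.I) ^ 4 = 1 := by
  rw [Even.neg_pow (by decide), Complex.I_pow_four]

lemma mul_deriv_negLogHalfCos {t : ℝ} (ht : t ∈ Ioo (0 : ℝ) 1) :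
    t * (2 / (1 + t ^ 2) * halfSin t / halfCos t) =
      2 * t ^ 2 / (1 - t ^ 2) + 2 * t ^ 2 / (1 + t ^ 2) := by
  have h1 : 1 + t ^ 2 ≠ 0 := by positivity
  have h2 : 1 - t ^ 2 ≠ 0 := by nlinarith [ht.1, ht.2]
  rw [halfSin, halfCos]
  field_simp
  ring

/-- Integration against `d (-log cos θ)`, a combination of the letters `1`, `-1`, `I`, `-I`. -/
lemma log_letters_mem_polylogEuler {w : ℕ} {f : ℝ → ℂ} (hf : f ∈ polylogFun 4 w) :
    (fun t : ℝ => (1 * t / (1 - 1 * t) * f t + -1 * t / (1 - -1 * t) * f t) -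
      (Complex.I * t / (1 - Complex.I * t) * f t +
        -Complex.I * t / (1 - -Complex.I * t) * f t)) ∈ polylogEuler 4 (w + 1) :=
  sub_mem (add_mem (letter_mul_mem_polylogEuler (by norm_num) (by norm_num) hf)
      (letter_mul_mem_polylogEuler (by norm_num) (by norm_num) hf))
    (add_mem (letter_mul_mem_polylogEuler (by norm_num) (by norm_num) hf)
      (letter_mul_mem_polylogEuler (by norm_num) neg_I_pow_four hf))

/-- Integration against `I dθ`, with `dθ = 2 dt / (1 + t²)`. -/
lemma angle_letters_mem_polylogEuler {w : ℕ} {f : ℝ → ℂ} (hf : f ∈ polylogFun 4 w) :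
    (fun t : ℝ => Complex.I * t / (1 - Complex.I * t) * f t -
        -Complex.I * t / (1 - -Complex.I * t) * f t) ∈ polylogEuler 4 (w + 1) :=
  sub_mem (letter_mul_mem_polylogEuler (by norm_num) (by norm_num) hf)
      (letter_mul_mem_polylogEuler (by norm_num) neg_I_pow_four hf)

/-- Integration against `d log (sin θ)`. -/
lemma sin_letters_mem_polylogEuler {w : ℕ} {f : ℝ → ℂ} (hf : f ∈ polylogFun 4 (w + 1)) :
    (fun t : ℝ => f t + (Complex.I * t / (1 - Complex.I * t) * f t +
        -Complex.I * t / (1 - -Complex.I * t) * f t)) ∈ polylogEuler 4 (w + 2) :=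
  add_mem (mem_polylogEuler_of_mem_polylogFun hf)
    (add_mem (letter_mul_mem_polylogEuler (by norm_num) (by norm_num) hf)
      (letter_mul_mem_polylogEuler (by norm_num) neg_I_pow_four hf))

/-- `logArcsinPolylog (k - 1) q m`, with the convention that it is zero for `k = 0`; it is what
differentiating the logarithmic factor leaves. -/
noncomputable def logArcsinPolylogPred (k q m : ℕ) (t : ℝ) : ℂ :=
  Complex.I ^ q *
    ((dividedPowDeriv k (negLogHalfCos t) * arcsinPolylog q m (halfSin t) : ℝ) : ℂ)

lemma logArcsinPolylogPred_mem {k q m w : ℕ}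
    (h : ∀ k', k = k' + 1 → logArcsinPolylog k' q m ∈ polylogFun 4 w) :
    logArcsinPolylogPred k q m ∈ polylogFun 4 w := by
  rcases k with _ | k
  · convert! zero_mem (polylogFun 4 w) using 1
    funext t
    simp [logArcsinPolylogPred, dividedPowDeriv]
  · convert! h k rfl using 1

/-- Powers of logarithm and angle: `I ^ q (-log cos θ) ^ k θ ^ q / (k! q!)` is a polylogarithm of
weight `k + q`. -/
lemma logArcsinPolylog_zero_mem (s : ℕ) : ∀ k q, k + q = s →
    logArcsinPolylog k q 0 ∈ polylogFun 4 s := by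
  induction s with
  | zero =>
    intro k q h
    obtain ⟨rfl, rfl⟩ : k = 0 ∧ q = 0 := by lia
    obtain ⟨c, hc, hs⟩ := one_mem_polylogFun 4
    refine ⟨c, hc, fun t ht => ?_⟩
    convert! hs t ht using 1
    simp [logArcsinPolylog, arcsinPolylog_zero_right 0 (halfSin_mem ht)]
  | succ s ih =>
    intro k q h
    have hA : logArcsinPolylogPred k q 0 ∈ polylogFun 4 s :=
      logArcsinPolylogPred_mem fun k' hk' => ih k' q (by lia)
    -- the function multiplying the letters of `dθ`, which carries one factor `I` less
    let C : ℝ → ℂ := fun t => Complex.I ^ (q - 1) * ((negLogHalfCos t ^ k / k.factorial *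
      dividedPowDeriv q (Real.arcsin (halfSin t)) : ℝ) : ℂ)
    have hC : C ∈ polylogFun 4 s := by
      rcases q with _ | q
      · convert! zero_mem (polylogFun 4 s) using 1
        funext t
        simp [C, dividedPowDeriv]
      · obtain ⟨c, hc, hs⟩ := ih k q (by lia)
        refine ⟨c, hc, fun t ht => ?_⟩
        convert! hs t ht using 1
        simp [C, logArcsinPolylog, arcsinPolylog_zero_right q (halfSin_mem ht), dividedPowDeriv]
    refine mem_polylogFun_of_hasDerivAt (by norm_num) (continuousOn_logArcsinPolylog k q 0)
      (logArcsinPolylog_apply_zero (by lia)) (fun t ht => ?_)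
      (add_mem (log_letters_mem_polylogEuler hA) (angle_letters_mem_polylogEuler hC))
    have ht' := Ioo_subset_Ico_self ht
    have hd := ((hasDerivAt_dividedPow k _).comp t (hasDerivAt_negLogHalfCos ht')).mul
      ((hasDerivAt_dividedPow q _).comp t (hasDerivAt_arcsin_halfSin ht'))
    have hd' := hd.ofReal_comp.const_mul (Complex.I ^ q)
    refine HasDerivAt.congr_of_eventuallyEq (f := fun t : ℝ => Complex.I ^ q *
      ((negLogHalfCos t ^ k / k.factorial * (Real.arcsin (halfSin t) ^ q / q.factorial) : ℝ) : ℂ))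
      ?_ ?_
    · convert! hd' using 1
      simp only [Pi.add_apply, ← add_mul, ← sub_mul, letter_I_add, letter_I_sub,
        letter_one_add ht, logArcsinPolylogPred, arcsinPolylog_zero_right q (halfSin_mem ht'), C,
        Function.comp]
      have hI : Complex.I * Complex.I ^ (q - 1) * dividedPowDeriv q (Real.arcsin (halfSin t)) =
          Complex.I ^ q * dividedPowDeriv q (Real.arcsin (halfSin t)) := by
        rcases q with _ | q
        · simp [dividedPowDeriv]
        · rw [Nat.add_sub_cancel, pow_succ']
      have key := congrArg Complex.ofReal (mul_deriv_negLogHalfCos ht)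
      have key' := congrArg Complex.ofReal
        (show t * (2 / (1 + t ^ 2)) = 2 * t / (1 + t ^ 2) by ring)
      have hne : (t : ℂ) ≠ 0 := by exact_mod_cast ht.1.ne'
      generalize 2 / (1 + t ^ 2) * halfSin t / halfCos t = r at *
      generalize 2 / (1 + t ^ 2) = e at *
      generalize 2 * t / (1 + t ^ 2) = e' at *
      generalize 2 * t ^ 2 / (1 + t ^ 2) = a at *
      generalize 2 * t ^ 2 / (1 - t ^ 2) = b at *
      generalize dividedPowDeriv q (Real.arcsin (halfSin t)) = u at *
      generalize dividedPowDeriv k (negLogHalfCos t) = v at *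
      rw [div_eq_iff hne]
      simp only [Complex.ofReal_mul, Complex.ofReal_add, Complex.ofReal_neg] at key key' ⊢
      linear_combination (-(Complex.I ^ q) * v *
          ((Real.arcsin (halfSin t) ^ q / q.factorial : ℝ) : ℂ)) * key +
        ((negLogHalfCos t ^ k / k.factorial : ℝ) : ℂ) * e' * hI -
        Complex.I ^ q * ((negLogHalfCos t ^ k / k.factorial : ℝ) : ℂ) * u * key'
    · filter_upwards [Ioo_mem_nhds ht.1 ht.2] with s hs
      rw [logArcsinPolylog, arcsinPolylog_zero_right q (halfSin_mem (Ioo_subset_Ico_self hs))]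

lemma hasDerivAt_arcsinPolylog_halfSin {q : ℕ} (hq : q ≠ 0) (m : ℕ) {t : ℝ}
    (ht : t ∈ Ioo (0 : ℝ) 1) : HasDerivAt (fun t => arcsinPolylog q (m + 1) (halfSin t))
      (arcsinPolylog q m (halfSin t) * (2 / (1 + t ^ 2) * halfCos t / halfSin t)) t := by
  have hx : halfSin t ∈ Ioo (0 : ℝ) 1 :=
    ⟨div_pos (by linarith [ht.1]) (by positivity), (halfSin_mem (Ioo_subset_Ico_self ht)).2⟩
  convert! (hasDerivAt_arcsinPolylog hq m hx).comp t (hasDerivAt_halfSin t) using 1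
  ring

lemma mul_deriv_log_halfSin {t : ℝ} (ht : t ∈ Ioo (0 : ℝ) 1) :
    t * (2 / (1 + t ^ 2) * halfCos t / halfSin t) = 1 - 2 * t ^ 2 / (1 + t ^ 2) := by
  have h1 : 1 + t ^ 2 ≠ 0 := by positivity
  have h2 : t ≠ 0 := ht.1.ne'
  rw [halfSin, halfCos]
  field_simp
  ring

/-- Besides the forms `dθ` and `d (-log cos θ)` only `d log (sin θ)` occurs, which is `dt / t` plus
the letters `I` and `-I`. -/
lemma logArcsinPolylog_mem {q : ℕ} (hq : q ≠ 0) (m : ℕ) : ∀ k,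
    logArcsinPolylog k q m ∈ polylogFun 4 (k + q + m) := by
  induction m with
  | zero => exact fun k => logArcsinPolylog_zero_mem _ k q rfl
  | succ m ihm =>
    have step : ∀ k, logArcsinPolylogPred k q (m + 1) ∈ polylogFun 4 (k + q + m) →
        logArcsinPolylog k q (m + 1) ∈ polylogFun 4 (k + q + m + 1) := by
      intro k hA
      have hB := ihm k
      obtain ⟨w, hw⟩ : ∃ w, k + q + m = w + 1 := ⟨k + q + m - 1, by lia⟩
      rw [hw] at hA hB ⊢
      refine mem_polylogFun_of_hasDerivAt (by norm_num) (continuousOn_logArcsinPolylog k q (m + 1))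
        (logArcsinPolylog_apply_zero (by lia)) (fun t ht => ?_)
        (add_mem (log_letters_mem_polylogEuler hA) (sin_letters_mem_polylogEuler hB))
      have ht' := Ioo_subset_Ico_self ht
      have hd := ((hasDerivAt_dividedPow k _).comp t (hasDerivAt_negLogHalfCos ht')).mul
        (hasDerivAt_arcsinPolylog_halfSin hq m ht)
      convert! hd.ofReal_comp.const_mul (Complex.I ^ q) using 1
      simp only [Pi.add_apply, ← add_mul, ← sub_mul, letter_I_add, letter_one_add ht,
        logArcsinPolylogPred, logArcsinPolylog, Function.comp]
      have key := congrArg Complex.ofReal (mul_deriv_negLogHalfCos ht)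
      have key' := congrArg Complex.ofReal (mul_deriv_log_halfSin ht)
      have hne : (t : ℂ) ≠ 0 := by exact_mod_cast ht.1.ne'
      generalize 2 / (1 + t ^ 2) * halfSin t / halfCos t = r at *
      generalize 2 / (1 + t ^ 2) * halfCos t / halfSin t = e at *
      generalize 2 * t ^ 2 / (1 + t ^ 2) = a at *
      generalize 2 * t ^ 2 / (1 - t ^ 2) = b at *
      generalize dividedPowDeriv k (negLogHalfCos t) = v at *
      rw [div_eq_iff hne]
      simp only [Complex.ofReal_mul, Complex.ofReal_add, Complex.ofReal_neg, Complex.ofReal_sub,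
        Complex.ofReal_one] at key key' ⊢
      linear_combination
        (-(Complex.I ^ q) * v * (arcsinPolylog q (m + 1) (halfSin t) : ℂ)) * key -
        Complex.I ^ q * ((negLogHalfCos t ^ k / k.factorial : ℝ) : ℂ) *
          (arcsinPolylog q m (halfSin t) : ℂ) * key'
    intro k
    induction k with
    | zero => exact step 0 (logArcsinPolylogPred_mem fun k' hk' => by lia)
    | succ k ihk =>
      refine step (k + 1) (logArcsinPolylogPred_mem fun k' hk' => ?_)
      obtain rfl : k = k' := by lia
      convert! ihk using 2
      lia

/-! ### Wallis integrals with powers of the logarithm -/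

/-- The integral `∫ sin θ ^ n (-log cos θ) ^ k / k! dθ / sin θ` over `(0, π / 2)`, in the variable
`t = tan (θ / 2)`, for which `dθ / sin θ = dt / t`. -/
noncomputable def logWallis (n k : ℕ) : ℝ :=
  ∫ t in Ioo (0 : ℝ) 1, halfSin t ^ n * (negLogHalfCos t ^ k / k.factorial) / t

lemma norm_logArcsinPolylog {k q m : ℕ} {t : ℝ} (ht : t ∈ Ioo (0 : ℝ) 1) :
    ‖logArcsinPolylog k q m t / t‖ =
      negLogHalfCos t ^ k / k.factorial * arcsinPolylog q m (halfSin t) / t := by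
  have ht' := Ioo_subset_Ico_self ht
  have h1 := negLogHalfCos_nonneg ht'
  have h2 : 0 ≤ arcsinPolylog q m (halfSin t) := tsum_nonneg fun n =>
    mul_nonneg (div_nonneg (arcsinPowCoeff_nonneg_le_one n q).1 (by positivity))
      (pow_nonneg (halfSin_nonneg ht') n)
  rw [logArcsinPolylog, norm_div, norm_mul, norm_pow, Complex.norm_I, one_pow, one_mul,
    Complex.norm_real, Complex.norm_real, Real.norm_of_nonneg ht.1.le,
    Real.norm_of_nonneg (by positivity)]

lemma integrableOn_log_mul_arcsinPolylog {q : ℕ} (hq : q ≠ 0) (k m : ℕ) :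
    IntegrableOn (fun t => negLogHalfCos t ^ k / k.factorial * arcsinPolylog q m (halfSin t) / t)
      (Ioo 0 1) := by
  have h := logArcsinPolylog_mem hq m k
  obtain ⟨w, hw⟩ : ∃ w, k + q + m = w + 1 := ⟨k + q + m - 1, by lia⟩
  rw [hw] at h
  exact IntegrableOn.congr_fun (Integrable.norm (integral_div_mem_CMZV (by norm_num) h).1)
    (fun t ht => norm_logArcsinPolylog ht) measurableSet_Ioo

lemma continuousOn_halfSin_pow_mul_log (n k : ℕ) :
    ContinuousOn (fun t => halfSin t ^ n * (negLogHalfCos t ^ k / k.factorial) / t) (Ioo 0 1) := by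
  intro t ht
  have h1 := (hasDerivAt_negLogHalfCos (Ioo_subset_Ico_self ht)).continuousAt
  have h2 := (hasDerivAt_halfSin t).continuousAt
  exact (((h2.pow n).mul ((h1.pow k).div_const _)).div continuousAt_id ht.1.ne').continuousWithinAt

/-- The comparison `sin θ ^ n ≤ sin θ ≤ θ` reduces integrability to that of polylogarithms. -/
lemma integrableOn_logWallis {n : ℕ} (hn : n ≠ 0) (k : ℕ) :
    IntegrableOn (fun t => halfSin t ^ n * (negLogHalfCos t ^ k / k.factorial) / t) (Ioo 0 1) := by
  refine Integrable.mono (integrableOn_log_mul_arcsinPolylog one_ne_zero k 0)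
    ((continuousOn_halfSin_pow_mul_log n k).aestronglyMeasurable measurableSet_Ioo)
    ((ae_restrict_iff' measurableSet_Ioo).2 (Eventually.of_forall fun t ht => ?_))
  have ht' := Ioo_subset_Ico_self ht
  have h1 := negLogHalfCos_nonneg ht'
  have hx := halfSin_nonneg ht'
  have hx' := halfSin_mem ht'
  have ha : 0 ≤ Real.arcsin (halfSin t) := Real.arcsin_nonneg.2 hx
  have hle : halfSin t ^ n ≤ Real.arcsin (halfSin t) :=
    calc halfSin t ^ n ≤ halfSin t := pow_le_of_le_one hx hx'.2.le hn
      _ = Real.sin (Real.arcsin (halfSin t)) := (Real.sin_arcsin hx'.1.le hx'.2.le).symm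
      _ ≤ _ := Real.sin_le ha
  have ht0 := ht.1
  rw [arcsinPolylog_zero_right 1 hx', pow_one, Nat.factorial_one, Nat.cast_one, div_one,
    Real.norm_of_nonneg (by positivity), Real.norm_of_nonneg (by positivity)]
  rw [mul_comm (halfSin t ^ n)]
  gcongr

lemma tendsto_mul_log_pow (k : ℕ) :
    Tendsto (fun x : ℝ => x * (-Real.log x) ^ k) (𝓝[>] 0) (𝓝 0) := by
  have h := (Real.isLittleO_pow_log_id_atTop (n := k)).tendsto_div_nhds_zero.comp
    tendsto_inv_nhdsGT_zero
  refine h.congr' (eventually_nhdsWithin_of_forall fun x _ => ?_)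
  simp [mul_comm]

/-- The function whose derivative yields the recursion for `logWallis`. -/
lemma hasDerivAt_logWallis_primitive (j k : ℕ) {t : ℝ} (ht : t ∈ Ioo (0 : ℝ) 1) :
    HasDerivAt (fun t => halfSin t ^ j * (halfCos t * (negLogHalfCos t ^ k / k.factorial)))
      (j * (halfSin t ^ j * (negLogHalfCos t ^ k / k.factorial) / t) -
        (j + 1) * (halfSin t ^ (j + 2) * (negLogHalfCos t ^ k / k.factorial) / t) +
        halfSin t ^ (j + 2) * dividedPowDeriv k (negLogHalfCos t) / t) t := by
  have ht' := Ioo_subset_Ico_self ht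
  convert! ((hasDerivAt_halfSin t).pow j).mul ((hasDerivAt_halfCos t).mul
    ((hasDerivAt_dividedPow k _).comp t (hasDerivAt_negLogHalfCos ht'))) using 1
  have hy := (halfCos_pos ht').ne'
  have hs : 2 / (1 + t ^ 2) = halfSin t / t := by
    have := ht.1.ne'
    rw [halfSin]
    field_simp
  have hc := halfSin_sq_add_halfCos_sq t
  have hj : (j : ℝ) * halfSin t ^ (j - 1) * halfSin t = j * halfSin t ^ j := by
    rcases j with _ | j
    · simp
    · rw [Nat.add_sub_cancel, pow_succ]; ring
  rw [hs]
  have := ht.1.ne'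
  simp only [Pi.mul_apply, Pi.pow_apply, Function.comp]
  generalize negLogHalfCos t ^ k / (k.factorial : ℝ) = u
  field_simp
  linear_combination -(halfCos t ^ 2) * u * hj - u * j * halfSin t ^ j * hc

/-- Integration by parts in `∫ sin θ ^ (j + 1) (-log cos θ) ^ k / k! dθ`. For `j = 0` the integral
`logWallis j k` may diverge, but it is multiplied by `0`; the last term is the boundary value of the
primitive at `t = 0`. -/
lemma logWallis_recurrence (j k : ℕ) :
    ((j : ℝ) + 1) * logWallis (j + 2) k = j * logWallis j k +
      (if k = 0 then 0 else logWallis (j + 2) (k - 1)) + if j = 0 ∧ k = 0 then 1 else 0 := by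
  have hi1 : IntegrableOn (fun t => (j : ℝ) * (halfSin t ^ j *
      (negLogHalfCos t ^ k / k.factorial) / t)) (Ioo 0 1) := by
    by_cases hj : j = 0
    · simp [hj]
    · exact (integrableOn_logWallis hj k).const_mul _
  have hi2 : IntegrableOn (fun t => ((j : ℝ) + 1) * (halfSin t ^ (j + 2) *
      (negLogHalfCos t ^ k / k.factorial) / t)) (Ioo 0 1) :=
    (integrableOn_logWallis (by lia) k).const_mul _
  have hi3 : IntegrableOn (fun t => halfSin t ^ (j + 2) *
      dividedPowDeriv k (negLogHalfCos t) / t) (Ioo 0 1) ∧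
      ∫ t in Ioo (0 : ℝ) 1, halfSin t ^ (j + 2) * dividedPowDeriv k (negLogHalfCos t) / t =
        if k = 0 then 0 else logWallis (j + 2) (k - 1) := by
    by_cases hk : k = 0
    · simp [hk, dividedPowDeriv]
    · simp only [dividedPowDeriv, if_neg hk]
      exact ⟨integrableOn_logWallis (by lia) (k - 1), rfl⟩
  have h0 : Tendsto (fun t => halfSin t ^ j * (halfCos t * (negLogHalfCos t ^ k / k.factorial)))
      (𝓝[>] 0) (𝓝 (if j = 0 ∧ k = 0 then 1 else 0)) := by
    have c1 := (hasDerivAt_negLogHalfCos (t := 0) (by simp)).continuousAt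
    have c2 := (hasDerivAt_halfSin 0).continuousAt
    have c3 := (hasDerivAt_halfCos 0).continuousAt
    have : ContinuousAt (fun t => halfSin t ^ j *
      (halfCos t * (negLogHalfCos t ^ k / k.factorial))) 0 :=
      (c2.pow j).mul (c3.mul ((c1.pow k).div_const _))
    have h := this.tendsto
    have e0 : halfSin 0 = 0 := by simp [halfSin]
    have e1 : negLogHalfCos 0 = 0 := by simp [negLogHalfCos, halfCos]
    have e2 : halfCos 0 = 1 := by simp [halfCos]
    rw [e0, e1, e2] at h
    convert! h.mono_left nhdsWithin_le_nhds using 2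
    by_cases hj : j = 0 <;> by_cases hk : k = 0 <;> simp [hj, hk]
  -- at `t = 1` the zero of `cos θ` beats the power of the logarithm
  have h1 : Tendsto (fun t => halfSin t ^ j * (halfCos t * (negLogHalfCos t ^ k / k.factorial)))
      (𝓝[<] 1) (𝓝 0) := by
    have c2 := (hasDerivAt_halfSin 1).continuousAt.tendsto.mono_left
      (nhdsWithin_le_nhds (s := Iio 1))
    have c3 : Tendsto halfCos (𝓝[<] 1) (𝓝[>] 0) := by
      refine tendsto_nhdsWithin_iff.2 ⟨?_, ?_⟩
      · have := (hasDerivAt_halfCos 1).continuousAt.tendsto.mono_left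
          (nhdsWithin_le_nhds (s := Iio 1))
        rwa [show halfCos 1 = 0 by simp [halfCos]] at this
      · filter_upwards [Ioo_mem_nhdsLT (zero_lt_one (α := ℝ))] with t ht
        exact halfCos_pos (Ioo_subset_Ico_self ht)
    have := (c2.pow j).mul (((tendsto_mul_log_pow k).comp c3).div_const (k.factorial : ℝ))
    simp only [zero_div, mul_zero] at this
    refine this.congr fun t => ?_
    simp [negLogHalfCos, mul_div_assoc]
  have hsub : IntegrableOn (fun t => (j : ℝ) * (halfSin t ^ j *
      (negLogHalfCos t ^ k / k.factorial) / t) - ((j : ℝ) + 1) * (halfSin t ^ (j + 2) *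
      (negLogHalfCos t ^ k / k.factorial) / t)) (Ioo 0 1) := hi1.sub hi2
  have key := intervalIntegral.integral_eq_sub_of_hasDerivAt_of_tendsto zero_lt_one
    (fun t ht => hasDerivAt_logWallis_primitive j k ht)
    ((intervalIntegrable_iff_integrableOn_Ioo_of_le zero_le_one).2 (hsub.add hi3.1)) h0 h1
  rw [intervalIntegral.integral_of_le zero_le_one, integral_Ioc_eq_integral_Ioo,
    integral_add hsub hi3.1, integral_sub hi1 hi2, integral_const_mul, integral_const_mul,
    hi3.2] at key
  simp only [logWallis] at key ⊢
  linarith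

/-- The Wallis integrals `∫ sin θ ^ (2 n) dθ`. -/
lemma logWallis_odd (n : ℕ) : logWallis (2 * n + 1) 0 = Real.pi / 2 * centralRatio n := by
  induction n with
  | zero =>
    have : ∀ t ∈ Ioo (0 : ℝ) 1, halfSin t ^ (2 * 0 + 1) * (negLogHalfCos t ^ 0 /
        (Nat.factorial 0)) / t = 2 * (1 / (1 + t ^ 2)) := by
      intro t ht
      have := ht.1.ne'
      simp [halfSin]
      field_simp
    rw [logWallis, setIntegral_congr_fun measurableSet_Ioo this, integral_const_mul,
      ← integral_Ioc_eq_integral_Ioo, ← intervalIntegral.integral_of_le zero_le_one,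
      integral_one_div_one_add_sq, centralRatio_zero, Real.arctan_one, Real.arctan_zero]
    ring
  | succ n ih =>
    have h := logWallis_recurrence (2 * n + 1) 0
    simp only [if_true, ih, and_true] at h
    rw [if_neg (by lia)] at h
    have hb := centralRatio_succ n
    rw [show 2 * (n + 1) + 1 = 2 * n + 1 + 2 by ring]
    push_cast at h
    have h2 : (2 * (n : ℝ) + 2) ≠ 0 := by positivity
    apply mul_left_cancel₀ h2
    linear_combination h - Real.pi / 2 * hb

lemma multipleTHarmonicStarSum_zero_succ (k : ℕ) :
    multipleTHarmonicStarSum 0 (List.replicate (k + 1) 1) = 0 := by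
  simp [multipleTHarmonicStarSum, List.replicate_succ, nestedStarSum]

lemma multipleTHarmonicStarSum_succ (n k : ℕ) :
    multipleTHarmonicStarSum (n + 1) (List.replicate (k + 1) 1) =
      multipleTHarmonicStarSum n (List.replicate (k + 1) 1) +
        multipleTHarmonicStarSum (n + 1) (List.replicate k 1) / (2 * n + 1) := by
  simp only [multipleTHarmonicStarSum, List.replicate_succ, List.map_cons, nestedStarSum_succ]
  push_cast
  rw [show 2 * ((n : ℝ) + 1) - 1 = 2 * n + 1 by ring]
  ring

/-- The star sums arise from expanding `∫ sin θ ^ (2 n + 1) (-log cos θ) ^ k / k! dθ` by means of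
`logWallis_recurrence`, which matches the recursion of `t⋆` in depth and length. -/
lemma logWallis_even (n : ℕ) : ∀ k, logWallis (2 * (n + 1)) k =
    multipleTHarmonicStarSum (n + 1) (List.replicate k 1) /
      (centralRatio (n + 1) * (2 * (n + 1))) := by
  have hnil : ∀ n, multipleTHarmonicStarSum n (List.replicate 0 1) = 1 := fun n => by
    simp [multipleTHarmonicStarSum, nestedStarSum]
  induction n with
  | zero =>
    have hb := centralRatio_succ 0
    rw [centralRatio_zero] at hb
    have hb' : centralRatio (0 + 1) = 1 / 2 := by push_cast at hb; linarith
    intro k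
    rw [hb']
    induction k with
    | zero =>
      have h := logWallis_recurrence 0 0
      rw [hnil]
      norm_num at h ⊢
      exact h
    | succ k ih =>
      have h := logWallis_recurrence 0 (k + 1)
      rw [multipleTHarmonicStarSum_succ, multipleTHarmonicStarSum_zero_succ]
      norm_num at h ih ⊢
      rw [h, ih]
  | succ n ihn =>
    have hb : centralRatio (n + 1 + 1) = (2 * n + 3) * centralRatio (n + 1) / (2 * n + 4) := by
      have := centralRatio_succ (n + 1)
      push_cast at this
      field_simp
      linear_combination this
    have hpos := (centralRatio_pos (n + 1)).ne'
    have h3 : (2 * (n : ℝ) + 3) ≠ 0 := by positivity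
    intro k
    induction k with
    | zero =>
      have h := logWallis_recurrence (2 * (n + 1)) 0
      rw [ihn 0, hnil] at h
      rw [hnil, hb, show 2 * (n + 1 + 1) = 2 * (n + 1) + 2 by ring]
      simp only [if_true, and_true] at h
      rw [if_neg (by lia)] at h
      push_cast at h ⊢
      apply mul_left_cancel₀ h3
      field_simp at h ⊢
      linear_combination (2 * (n : ℝ) + 4) * h
    | succ k ih =>
      have h := logWallis_recurrence (2 * (n + 1)) (k + 1)
      rw [if_neg (by lia), if_neg (by lia), ihn (k + 1), Nat.add_sub_cancel,
        show 2 * (n + 1) + 2 = 2 * (n + 1 + 1) by ring, ih, hb] at h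
      rw [hb, multipleTHarmonicStarSum_succ]
      push_cast at h ⊢
      apply mul_left_cancel₀ h3
      have e : (2 * (n : ℝ) + 3) * logWallis (2 * (n + 1 + 1)) (k + 1) =
        (2 * (n + 1) + 1) * logWallis (2 * (n + 1 + 1)) (k + 1) := by ring
      rw [e, h]
      field_simp
      ring

/-! ### Interchange of sum and integral, and the two series -/

/-- Termwise integration of a nonnegative series with integrable sum. -/
lemma hasSum_integral_of_nonneg {α : Type*} {m : MeasurableSpace α} {μ : Measure α}
    {F : ℕ → α → ℝ} {g : α → ℝ} (hF : ∀ n, Integrable (F n) μ) (hg : Integrable g μ)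
    (hF0 : ∀ n, 0 ≤ᵐ[μ] F n) (hs : ∀ᵐ a ∂μ, HasSum (fun n => F n a) (g a)) :
    HasSum (fun n => ∫ a, F n a ∂μ) (∫ a, g a ∂μ) := by
  have hnorm : ∀ n, ∫ a, ‖F n a‖ ∂μ = ∫ a, F n a ∂μ := fun n =>
    integral_congr_ae ((hF0 n).mono fun a ha => Real.norm_of_nonneg ha)
  have hall : ∀ᵐ a ∂μ, ∀ n, 0 ≤ F n a := ae_all_iff.2 hF0
  have hsum : Summable fun n => ∫ a, ‖F n a‖ ∂μ := by
    refine summable_of_sum_le (c := ∫ a, g a ∂μ) (fun n => integral_nonneg fun a => norm_nonneg _)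
      fun u => ?_
    simp only [hnorm]
    rw [← integral_finsetSum u fun n _ => hF n]
    refine integral_mono_ae (integrable_finsetSum u fun n _ => hF n) hg ?_
    filter_upwards [hall, hs] with a h0 ha
    exact sum_le_hasSum u (fun n _ => h0 n) ha
  have h := hasSum_integral_of_summable_integral_norm hF hsum
  rwa [integral_congr_ae (hs.mono fun a ha => ha.tsum_eq)] at h

/-- Both series of the theorem are, up to a rational or `2 / π` multiple, instances of this one: the
first with `q` odd and `k = 0`, the second with `q` even. -/
lemma exists_hasSum_arcsinPowCoeff_mul_logWallis {q : ℕ} (hq : q ≠ 0) (k m : ℕ) :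
    ∃ S : ℝ, HasSum (fun n : ℕ => arcsinPowCoeff q n / (n : ℝ) ^ m * logWallis n k) S ∧
      Complex.I ^ q * (S : ℂ) ∈ CMZV 4 (k + q + m + 1) := by
  let g : ℝ → ℝ := fun t => negLogHalfCos t ^ k / k.factorial * arcsinPolylog q m (halfSin t) / t
  refine ⟨∫ t in Ioo (0 : ℝ) 1, g t, ?_, ?_⟩
  · let F : ℕ → ℝ → ℝ := fun n t => arcsinPowCoeff q n / (n : ℝ) ^ m *
      (halfSin t ^ n * (negLogHalfCos t ^ k / k.factorial) / t)
    have hF : ∀ n, IntegrableOn (F n) (Ioo 0 1) := by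
      intro n
      by_cases hn : n = 0
      · simp [F, hn, arcsinPowCoeff_zero_right hq]
      · exact (integrableOn_logWallis hn k).const_mul _
    have h := hasSum_integral_of_nonneg (F := F) (g := g) hF
      (integrableOn_log_mul_arcsinPolylog hq k m)
      (fun n => (ae_restrict_iff' measurableSet_Ioo).2 (Eventually.of_forall fun t ht => ?_))
      ((ae_restrict_iff' measurableSet_Ioo).2 (Eventually.of_forall fun t ht => ?_))
    · simpa only [F, integral_const_mul] using! h
    · have ht' := Ioo_subset_Ico_self ht
      have h1 := negLogHalfCos_nonneg ht'
      have h2 := halfSin_nonneg ht'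
      have h3 := (arcsinPowCoeff_nonneg_le_one n q).1
      have h4 := ht.1
      simp only [F, Pi.zero_apply]
      positivity
    · have h := ((hasSum_arcsinPolylog q m (halfSin_mem (Ioo_subset_Ico_self ht))).mul_left
        (negLogHalfCos t ^ k / k.factorial)).div_const t
      convert! h using 2 with n
      simp only [F]
      ring
  · have h := logArcsinPolylog_mem hq m k
    obtain ⟨w, hw⟩ : ∃ w, k + q + m = w + 1 := ⟨k + q + m - 1, by lia⟩
    rw [hw] at h ⊢
    convert! (integral_div_mem_CMZV (by norm_num) h).2 using 1
    rw [← integral_complex_ofReal, ← integral_const_mul]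
    refine setIntegral_congr_fun measurableSet_Ioo fun t _ => ?_
    simp only [g, logArcsinPolylog]
    push_cast
    ring

lemma rat_smul_mem_CMZV {N w : ℕ} {z : ℂ} (hz : z ∈ CMZV N w) (r : ℚ) :
    (r : ℂ) * z ∈ CMZV N w := by
  rw [← Rat.smul_def]
  exact Submodule.smul_mem _ r hz

lemma exists_hasSum_centralRatio_sq_tHarmonic (p m : ℕ) : ∃ z ∈ CMZV 4 (2 * p + m + 2),
    HasSum (fun n : ℕ => ((centralRatio n ^ 2 * (multipleTHarmonicSum n (List.replicate p 2) /
      (2 * (n : ℝ) + 1) ^ (m + 1)) : ℝ) : ℂ)) (Complex.I / (Real.pi : ℂ) * z) := by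
  obtain ⟨S, hS, hz⟩ :=
    exists_hasSum_arcsinPowCoeff_mul_logWallis (q := 2 * p + 1) (by lia) 0 m
  have hinj : Function.Injective fun n : ℕ => 2 * n + 1 := fun a b h => by simpa using h
  rw [← hinj.hasSum_iff] at hS
  · have hpi : (Real.pi : ℂ) ≠ 0 := by exact_mod_cast Real.pi_ne_zero
    have h1 : ((-1 : ℂ) ^ p) * (-1) ^ p = 1 := by rw [← mul_pow]; simp
    refine ⟨((-2 * (-1) ^ p : ℚ) : ℂ) * (Complex.I ^ (2 * p + 1) * S),
      rat_smul_mem_CMZV (by convert! hz using 2; ring) _, ?_⟩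
    have key : Complex.I / (Real.pi : ℂ) * (((-2 * (-1) ^ p : ℚ) : ℂ) *
        (Complex.I ^ (2 * p + 1) * S)) = ((2 / Real.pi * S : ℝ) : ℂ) := by
      rw [pow_succ, pow_mul, Complex.I_sq]
      push_cast
      field_simp
      linear_combination (-(Complex.I ^ 2) * S) * h1 - S * Complex.I_sq
    rw [key, Complex.hasSum_ofReal]
    convert! hS.mul_left (2 / Real.pi) using 1
    funext n
    simp only [Function.comp, arcsinPowCoeff_odd, logWallis_odd]
    have := Real.pi_ne_zero
    push_cast
    field_simp
    ring
  · intro n hn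
    obtain ⟨l, rfl⟩ : ∃ l, n = 2 * l := by
      rcases Nat.even_or_odd' n with ⟨l, h | h⟩
      · exact ⟨l, h⟩
      · exact absurd ⟨l, h.symm⟩ hn
    simp [(arcsinPowCoeff_parity l p).2]

lemma exists_hasSum_inv_centralRatio_sq_harmonic (p k m : ℕ) :
    ∃ z ∈ CMZV 4 (2 * (p + 1) + k + (m + 1)),
    HasSum (fun n : ℕ => (((centralRatio (n + 1))⁻¹ ^ 2 *
      (multipleHarmonicSum n (List.replicate p 2) *
        multipleTHarmonicStarSum (n + 1) (List.replicate k 1) /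
        ((n : ℝ) + 1) ^ (m + 3)) : ℝ) : ℂ)) z := by
  obtain ⟨S, hS, hz⟩ :=
    exists_hasSum_arcsinPowCoeff_mul_logWallis (q := 2 * (p + 1)) (by lia) k m
  have hinj : Function.Injective fun n : ℕ => 2 * (n + 1) := fun a b h => by simpa using h
  rw [← hinj.hasSum_iff] at hS
  · refine ⟨(((-1) ^ (p + 1) * 4 ^ (p + 1) * 2 ^ (m + 1) : ℚ) : ℂ) *
      (Complex.I ^ (2 * (p + 1)) * S),
      rat_smul_mem_CMZV (by convert! hz using 2; ring) _, ?_⟩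
    have h1 : ((-1 : ℂ) ^ (p + 1)) * (-1) ^ (p + 1) = 1 := by rw [← mul_pow]; simp
    have key : (((-1) ^ (p + 1) * 4 ^ (p + 1) * 2 ^ (m + 1) : ℚ) : ℂ) *
        (Complex.I ^ (2 * (p + 1)) * S) = ((4 ^ (p + 1) * 2 ^ (m + 1) * S : ℝ) : ℂ) := by
      rw [pow_mul, Complex.I_sq]
      push_cast
      linear_combination ((4 : ℂ) ^ (p + 1) * 2 ^ (m + 1) * S) * h1
    rw [key, Complex.hasSum_ofReal]
    convert! hS.mul_left (4 ^ (p + 1) * 2 ^ (m + 1) : ℝ) using 1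
    funext n
    simp only [Function.comp, arcsinPowCoeff_even, logWallis_even]
    have := (centralRatio_pos (n + 1)).ne'
    push_cast
    rw [mul_pow, pow_succ 2 m, pow_add _ m 3]
    field_simp
  · intro n hn
    rcases Nat.even_or_odd' n with ⟨l, rfl | rfl⟩
    · rcases l with _ | l
      · simp [arcsinPowCoeff_zero_right (show 2 * (p + 1) ≠ 0 by lia)]
      · exact absurd ⟨l, rfl⟩ hn
    · simp [(arcsinPowCoeff_parity l (p + 1)).1]

theorem mainTheorem5 (p k m : ℕ) (hp : 1 ≤ p) (hk : 1 ≤ k) (hm : 1 ≤ m) :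
    (∃ z ∈ CMZV 4 (2 * p + m - 1),
      HasSum
        (fun n : Set.Ici (p - 1) =>
          (((((2 * (n : ℕ)).choose n : ℝ) / 4 ^ (n : ℕ)) ^ 2 *
              (multipleTHarmonicSum n (List.replicate (p - 1) 2) /
                (2 * ((n : ℕ) : ℝ) + 1) ^ m) : ℝ) : ℂ))
        (Complex.I / (Real.pi : ℂ) * z)) ∧
    (∃ z ∈ CMZV 4 (2 * p + k + m),
      HasSum
        (fun n : Set.Ici p =>
          ((((4 : ℝ) ^ (n : ℕ) / ((2 * (n : ℕ)).choose n : ℝ)) ^ 2 *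
              (multipleHarmonicSum ((n : ℕ) - 1) (List.replicate (p - 1) 2) *
                multipleTHarmonicStarSum n (List.replicate k 1) /
                ((n : ℕ) : ℝ) ^ (m + 2)) : ℝ) : ℂ))
        z) := by
  obtain ⟨p, rfl⟩ : ∃ p', p = p' + 1 := ⟨p - 1, by lia⟩
  obtain ⟨m, rfl⟩ : ∃ m', m = m' + 1 := ⟨m - 1, by lia⟩
  simp only [Nat.add_sub_cancel]
  refine ⟨?_, ?_⟩
  · obtain ⟨z, hz, hs⟩ := exists_hasSum_centralRatio_sq_tHarmonic p m
    refine ⟨z, by convert! hz using 2; lia, ?_⟩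
    rw [← hasSum_subtype_iff_of_support_subset (s := Ici p)] at hs
    · exact hs
    · intro n hn
      by_contra h
      refine hn ?_
      simp [multipleTHarmonicSum_eq_zero n p (not_le.1 h)]
  · obtain ⟨z, hz, hs⟩ := exists_hasSum_inv_centralRatio_sq_harmonic p k m
    refine ⟨z, hz, ?_⟩
    let u : ℕ → ℂ := fun n => ((((4 : ℝ) ^ n / ((2 * n).choose n : ℝ)) ^ 2 *
      (multipleHarmonicSum (n - 1) (List.replicate p 2) *
        multipleTHarmonicStarSum n (List.replicate k 1) / (n : ℝ) ^ (m + 1 + 2)) : ℝ) : ℂ)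
    have hu : HasSum u z := by
      rw [← hasSum_nat_add_iff' 1]
      convert! hs using 1
      · funext n
        simp only [u, centralRatio, inv_div, Nat.add_sub_cancel]
        push_cast
        rfl
      · simp [u]
    rw [← hasSum_subtype_iff_of_support_subset (s := Ici (p + 1))] at hu
    · exact hu
    · intro n hn
      by_contra h
      refine hn ?_
      rcases n with _ | n
      · simp [u]
      · have : n < p := by simpa using h
        simp [u, multipleHarmonicSum_eq_zero n p this]
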